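/- **Setting.** Graphs are finite, simple and undirected. The conductance of $G=(V,E)$ is $$\phi_G=\min_{\emptyset\ne S\subsetneq V}\frac{|\{(u,v)\in E:u\in S,\ v\in V\setminus S\}|}{\min\{\sum_{u\in S}d_u,\ \sum_{u\in V\setminus S}d_u\}}$$ (with $\phi_G=0$ if $G$ has an isolated vertex or only one vertex), and "expander" means that $\phi_G$ is at least a positive constant. The effective resistance is $r_G(s,t)=(\mathbf e_s-\mathbf e_t)^T L^\dagger(\mathbf e_s-\mathbf e_t)$ with $L$ the Laplacian of $G$ and $L^\dagger$ its Moore–Penrose pseudo-inverse. A number $x$ is an $\epsilon$-approximation of $y$ if $(1-\epsilon)y\le x\le(1+\epsilon)y$. A randomized local algorithm in the adjacency-query model knows the vertex set $V$ and accesses the graph only through degree queries ($u\mapsto d_u$), neighbor queries ($(u,i)\mapsto$ the $i$-th entry of the adjacency list of $u$) and jump queries (a fresh uniformly random vertex). Adjacency lists may be ordered arbitrarily, and algorithms must succeed for every ordering. **Theorem.** (1) There are constants $\phi,c>0$ such that for every $\epsilon\in(0,1)$ and every $N$ there are a graph $G$ with at least $N$ vertices and $\phi_G\ge\phi$, and vertices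 $s,t$ of $G$, with the following property. Let $A$ be any randomized local algorithm that, for every graph $G'$ on the vertex set of $G$ with $\phi_{G'}\ge\phi$, outputs an $\epsilon$-approximation of $r_{G'}(s,t)$ with probability at least $2/3$. Then, for every ordering of the adjacency lists of $G$, the expected (hence also the worst-case) number of queries of $A$ on $G$ is at least $c/\epsilon$. (2) Let $S_1,S_2$ be disjoint finite sets with $|S_1|=n_1$, $|S_2|=n_2$, let $H$ be a $d$-regular graph on $S_1$, let $d_s\in\mathbb N$, and let $s,t$ be two further vertices. For $N_1\subseteq S_1$, $N_2\subseteq S_2$ let $G(N_1,N_2)$ be the graph on $S_1\cup S_2\cup\{s,t\}$ that has the edges of $H$, the edges from $s$ to all vertices of $N_1\cup N_2$, and the edges from $t$ to all vertices of $S_1\cup S_2$. Put $x=\lfloor(1-\epsilon)d_s\rfloor$, and let $$\mathcal C_1=\{G(N_1,\emptyset):|N_1|=d_s\},\qquad \mathcal C_2=\{G(N_1,N_2):|N_1|=x,\ |N_2|=d_s-x\}.$$ Call $(S_1,S_2,H,d,d_s)$ *$(\phi,K,\epsilon)$-admissible* if $\phi_H\ge\phi$, $\;d_s\ge K/\epsilon$,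 $\;d_s\le n_2$, $\;Kn_2\le n_1$, $\;d\ge\max\{d_s\log n_1,\log^2 n_1\}$ and $n_1\ge 2d^3$. There is an absolute constant $c>0$ such that for every $\phi>0$ there are $K,\phi'>0$ such that for every $\epsilon\in(0,1)$ and every $(\phi,K,\epsilon)$-admissible choice: (a) all $G_1\in\mathcal C_1$ and $G_2\in\mathcal C_2$ are expanders, $\phi_{G_1},\phi_{G_2}\ge\phi'$, and $$|r_{G_1}(s,t)-r_{G_2}(s,t)|>\tfrac{\epsilon}{4}\,r_{G_1}(s,t);$$ (b) if a randomized local algorithm distinguishes $\mathcal C_1$ from $\mathcal C_2$ (it answers "1" on every graph of $\mathcal C_1$ and "2" on every graph of $\mathcal C_2$, each with probability at least $2/3$), then its expected number of queries on every $G_1\in\mathcal C_1$, for every ordering of the adjacency lists, is at least $c/\epsilon$. (3) There is $\phi>0$ such that for all $K>0$, $\epsilon\in(0,1)$ and $N$ there is a $(\phi,K,\epsilon)$-admissible choice with $n_1\ge N$. -/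

import Mathlib

noncomputable section

namespace ERLower

/-! ### Conductance and effective resistance of a finite simple graph -/

open Classical in
/-- The volume `∑_{u ∈ S} d_u` of a vertex set. -/
def vol {V : Type} [Fintype V] (G : SimpleGraph V) (S : Finset V) : ℕ :=
  ∑ u ∈ S, G.degree u

open Classical in
/-- The number of edges leaving `S`; each edge is counted once, from its endpoint in `S`. -/
def cut {V : Type} [Fintype V] (G : SimpleGraph V) (S : Finset V) : ℕ :=
  (Finset.univ.filter fun p : V × V => p.1 ∈ S ∧ p.2 ∉ S ∧ G.Adj p.1 p.2).card

open Classical in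
/-- The conductance: the minimum of `cut S / min (vol S, vol Sᶜ)` over the nonempty proper vertex
sets `S`. It is `0` if `G` is disconnected or has an isolated vertex (`0 / 0 = 0`) or has at most
one vertex. -/
def conductance {V : Type} [Fintype V] (G : SimpleGraph V) : ℝ :=
  ⨅ S : {S : Finset V // S.Nonempty ∧ Sᶜ.Nonempty},
    (cut G S.1 : ℝ) / min (vol G S.1 : ℝ) (vol G (S.1)ᶜ : ℝ)

open Classical in
/-- The Moore-Penrose pseudo-inverse of a real symmetric matrix: invert the nonzero eigenvalues in
an orthonormal eigenbasis, and keep the zero eigenvalues (`0⁻¹ = 0`). -/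
def pinv {V : Type} [Fintype V] (A : Matrix V V ℝ) (hA : A.IsHermitian) : Matrix V V ℝ :=
  (hA.eigenvectorUnitary : Matrix V V ℝ) *
    Matrix.diagonal (fun i => (hA.eigenvalues i)⁻¹) *
    star (hA.eigenvectorUnitary : Matrix V V ℝ)

open Classical in
/-- The graph Laplacian `D - A`. -/
def laplacian {V : Type} [Fintype V] (G : SimpleGraph V) : Matrix V V ℝ :=
  G.lapMatrix ℝ

theorem laplacian_isHermitian {V : Type} [Fintype V] (G : SimpleGraph V) :
    (laplacian G).IsHermitian := by
  classical
  have h : (laplacian G).IsSymm := SimpleGraph.isSymm_lapMatrix ℝ G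
  unfold Matrix.IsHermitian
  rw [Matrix.conjTranspose_eq_transpose_of_trivial]
  exact h

open Classical in
/-- The effective resistance `(e_s - e_t)ᵀ L† (e_s - e_t)`. -/
def effRes {V : Type} [Fintype V] (G : SimpleGraph V) (s t : V) : ℝ :=
  let b : V → ℝ := Pi.single s 1 - Pi.single t 1
  b ⬝ᵥ (pinv (laplacian G) (laplacian_isHermitian G)).mulVec b

/-! ### The adjacency-query model -/

/-- The queries: the degree of `u`, the `i`-th neighbour of `u` (counted from `0`), and a uniformly
random vertex. -/
inductive Query (V : Type) : Type where
  | degree (u : V) : Query V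
  | neighbor (u : V) (i : ℕ) : Query V
  | jump : Query V

/-- The answers: a degree, or a vertex (`none` if a neighbour index is out of range). -/
inductive Answer (V : Type) : Type where
  | degree (k : ℕ) : Answer V
  | vertex (v : Option V) : Answer V

open Classical in
/-- An adjacency-list representation of `G`: an ordering of the neighbours of every vertex. -/
def AdjLists {V : Type} [Fintype V] (G : SimpleGraph V) : Type :=
  (v : V) → Fin (G.degree v) ≃ G.neighborSet v

open Classical in
/-- The law of the answer to each query; every jump query draws a fresh uniform vertex. -/
def oracle {V : Type} [Fintype V] [Nonempty V] (G : SimpleGraph V) (σ : AdjLists G) :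
    Query V → PMF (Answer V)
  | .degree u => PMF.pure (.degree (G.degree u))
  | .neighbor u i =>
      PMF.pure (.vertex (if h : i < G.degree u then some (σ u ⟨i, h⟩ : V) else none))
  | .jump => (PMF.uniformOfFintype V).map fun v => .vertex (some v)

/-- A randomized query algorithm with vertex set `V` and outputs in `α`. In memory state `m` it
tosses coins and then either stops with an output or moves to a new memory state and asks a query;
the answer updates the memory. The memory is unrestricted. -/
structure Algo (V α : Type) : Type 1 where
  State : Type
  init : State
  next : State → PMF ((State × Query V) ⊕ α)
  receive : State → Answer V → State

namespace Algo

variable {V α : Type}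

/-- The law of the outcome from memory state `m` with a budget of `k` queries: `some a` if the
algorithm outputs `a` after at most `k` queries, `none` if it asks a `(k + 1)`-st query. -/
def run (A : Algo V α) (O : Query V → PMF (Answer V)) : ℕ → A.State → PMF (Option α)
  | 0, m => (A.next m).bind fun act =>
      match act with
      | .inl _ => PMF.pure none
      | .inr a => PMF.pure (some a)
  | k + 1, m => (A.next m).bind fun act =>
      match act with
      | .inl mq => (O mq.2).bind fun ans => run A O k (A.receive mq.1 ans)
      | .inr a => PMF.pure (some a)

/-- The probability that the algorithm stops with an output in `good`. -/
def successProb (A : Algo V α) (O : Query V → PMF (Answer V)) (good : Set α) : ENNReal :=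
  ⨆ k : ℕ, (A.run O k A.init).toOuterMeasure (some '' good)

/-- The expected number `∑_k P(more than k queries)` of queries (it is `∞` if the algorithm runs
forever with positive probability). It is a lower bound for the worst-case number of queries. -/
def expectedQueries (A : Algo V α) (O : Query V → PMF (Answer V)) : ENNReal :=
  ∑' k : ℕ, A.run O k A.init none

end Algo

/-- `x ≈_ε y`. -/
def Approx (ε x y : ℝ) : Prop := (1 - ε) * y ≤ x ∧ x ≤ (1 + ε) * y

/-- `A` computes, with probability at least `2/3`, an `ε`-approximation of the `s,t`-resistance of
every graph on `V` of conductance at least `φ`, however its adjacency lists are ordered. -/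
def ApproximatesER {V : Type} [Fintype V] [Nonempty V] (φ ε : ℝ) (s t : V) (A : Algo V ℝ) : Prop :=
  ∀ (G : SimpleGraph V) (σ : AdjLists G), φ ≤ conductance G →
    2 / 3 ≤ A.successProb (oracle G σ) {x | Approx ε x (effRes G s t)}

/-! ### The two families of graphs -/

/-- The vertices: the sets `S₁` and `S₂`, a source and a sink. -/
abbrev Vert (S₁ S₂ : Type) : Type := (S₁ ⊕ S₂) ⊕ Bool

/-- The source `s`. -/
def src {S₁ S₂ : Type} : Vert S₁ S₂ := .inr false

/-- The sink `t`. -/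
def snk {S₁ S₂ : Type} : Vert S₁ S₂ := .inr true

/-- The graph with the edges of `H` on `S₁`, no edges on `S₂`, the source joined to `N₁ ⊆ S₁` and
`N₂ ⊆ S₂`, and the sink joined to all of `S₁` and `S₂`. -/
def sourceSinkGraph {S₁ S₂ : Type} (H : SimpleGraph S₁) (N₁ : Finset S₁) (N₂ : Finset S₂) :
    SimpleGraph (Vert S₁ S₂) :=
  SimpleGraph.fromRel fun a b =>
    match a, b with
    | .inl (.inl u), .inl (.inl v) => H.Adj u v
    | .inr false, .inl (.inl v) => v ∈ N₁
    | .inr false, .inl (.inr v) => v ∈ N₂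
    | .inr true, .inl _ => True
    | _, _ => False

/-- `x = (1 - ε) d_s`, rounded down. -/
def keep (ε : ℝ) (ds : ℕ) : ℕ := ⌊(1 - ε) * (ds : ℝ)⌋₊

/-- The graphs `G₁`: all `ds` neighbours of the source lie in `S₁`. -/
def Family₁ {S₁ : Type} (S₂ : Type) (H : SimpleGraph S₁) (ds : ℕ) :
    Set (SimpleGraph (Vert S₁ S₂)) :=
  {G | ∃ N₁ : Finset S₁, N₁.card = ds ∧ G = sourceSinkGraph H N₁ ∅}

/-- The graphs `G₂`: `(1 - ε) ds` neighbours of the source lie in `S₁` and the others in `S₂`. -/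
def Family₂ {S₁ : Type} (S₂ : Type) (H : SimpleGraph S₁) (ε : ℝ) (ds : ℕ) :
    Set (SimpleGraph (Vert S₁ S₂)) :=
  {G | ∃ (N₁ : Finset S₁) (N₂ : Finset S₂), N₁.card = keep ε ds ∧ N₂.card = ds - keep ε ds ∧
    G = sourceSinkGraph H N₁ N₂}

open Classical in
/-- The conditions on the parameters. The constant `K` makes `ds ≫ 1/ε` and `n₂ ≪ n₁` precise. -/
structure Admissible {S₁ S₂ : Type} [Fintype S₁] [Fintype S₂] (φ K ε : ℝ)
    (H : SimpleGraph S₁) (d ds : ℕ) : Prop where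
  regular : ∀ v, H.degree v = d
  expander : φ ≤ conductance H
  source_large : K / ε ≤ ds
  source_le : ds ≤ Fintype.card S₂
  small : K * (Fintype.card S₂ : ℝ) ≤ Fintype.card S₁
  degree_large : (ds : ℝ) * Real.log (Fintype.card S₁) ≤ d
  degree_large' : Real.log (Fintype.card S₁) ^ 2 ≤ d
  size_large : 2 * d ^ 3 ≤ Fintype.card S₁

/-- `A` answers `true` on `𝒢₁` and `false` on `𝒢₂`, each with probability at least `2/3`, however
the adjacency lists are ordered. -/
def Distinguishes {V : Type} [Fintype V] [Nonempty V] (𝒢₁ 𝒢₂ : Set (SimpleGraph V))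
    (A : Algo V Bool) : Prop :=
  (∀ G ∈ 𝒢₁, ∀ σ : AdjLists G, 2 / 3 ≤ A.successProb (oracle G σ) {true}) ∧
  (∀ G ∈ 𝒢₂, ∀ σ : AdjLists G, 2 / 3 ≤ A.successProb (oracle G σ) {false})

end ERLower

end

/-!
The source is joined either to `ds` vertices of an expander `H`, or to about `(1 - ε) ds` vertices
of `H` and to `ε ds` vertices whose only other neighbour is the sink. A unit potential difference
drives a current of almost `1` through each neighbour in `H`, because the charge spreads over `H`
and leaks through the many sink edges: if the potential is below `1 / d` on most of `H`, Cheeger's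
inequality makes it expensive to be large at the neighbours of the source, and otherwise the sink
edges alone cost more than `ds`. Through a neighbour of degree two the current is at most `1 / 2`,
so the two resistances differ by a factor `1 + Ω(ε)`.

Moving the edge from the source to `u` over to a vertex `g u` of `S₂` changes one entry in the
adjacency list of the source, and otherwise only the answers at `u` and `g u`. So a query notices at
most one of the `ds` possible moves. Averaged over all sets of about `ε ds` moves, it notices the
change with probability `O(ε)`, and telling the two families apart takes `Ω(1 / ε)` queries.

The Hamming graph on words of length four provides admissible parameters: the `ℓ¹` Poincaré
inequality of the complete graph tensorizes and bounds its conductance from below, uniformly in the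
size of the alphabet.
-/

namespace ERLower

open scoped ENNReal

section Algorithms

theorem toOuterMeasure_le_one {β : Type*} (p : PMF β) (s : Set β) : p.toOuterMeasure s ≤ 1 := by
  rw [PMF.toOuterMeasure_apply, ← p.tsum_coe]
  exact ENNReal.tsum_le_tsum fun x => Set.indicator_le_self _ _ _

theorem toOuterMeasure_add_le_one {β : Type*} (p : PMF β) {s s' : Set β} (h : Disjoint s s') :
    p.toOuterMeasure s + p.toOuterMeasure s' ≤ 1 := by
  refine le_of_eq_of_le ?_ (toOuterMeasure_le_one p (s ∪ s'))
  simp only [PMF.toOuterMeasure_apply, ← ENNReal.tsum_add]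
  exact tsum_congr fun x => (congrFun (Set.indicator_union_of_disjoint h _) x).symm

namespace Algo

variable {V α : Type} (A : Algo V α) (O O' : Query V → PMF (Answer V))

theorem run_zero (m : A.State) :
    A.run O 0 m = (A.next m).bind fun act =>
      match act with
      | .inl _ => PMF.pure none
      | .inr a => PMF.pure (some a) := rfl

theorem run_succ (k : ℕ) (m : A.State) :
    A.run O (k + 1) m = (A.next m).bind fun act =>
      match act with
      | .inl mq => (O mq.2).bind fun ans => A.run O k (A.receive mq.1 ans)
      | .inr a => PMF.pure (some a) := rfl

/-- The expected number of queries in `B` among the first `k` queries of a run from memory state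
`m`; it measures how much of a run notices a change of the oracle on `B`. -/
noncomputable def expectedHits (B : Set (Query V)) : ℕ → A.State → ℝ≥0∞
  | 0, _ => 0
  | k + 1, m => ∑' act, A.next m act *
      match act with
      | .inl mq => B.indicator 1 mq.2 +
          ∑' ans, O mq.2 ans * expectedHits B k (A.receive mq.1 ans)
      | .inr _ => 0

theorem run_le_run_add_expectedHits (s : Set (Option α)) (k : ℕ) (m : A.State) :
    (A.run O k m).toOuterMeasure s ≤
      (A.run O' k m).toOuterMeasure s + A.expectedHits O {q | O' q ≠ O q} k m := by
  induction k generalizing m with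
  | zero => exact le_self_add
  | succ k ih =>
    simp only [run_succ, PMF.toOuterMeasure_bind_apply, expectedHits]
    rw [← ENNReal.tsum_add]
    refine ENNReal.tsum_le_tsum fun act => ?_
    rw [← mul_add]
    gcongr
    rcases act with ⟨m', q⟩ | a
    · by_cases hq : O' q = O q
      · have h_notMem : q ∉ {q | O' q ≠ O q} := not_not.2 hq
        simp only [PMF.toOuterMeasure_bind_apply, hq, Set.indicator_of_notMem h_notMem, zero_add]
        rw [← ENNReal.tsum_add]
        refine ENNReal.tsum_le_tsum fun ans => ?_
        rw [← mul_add]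
        gcongr
        exact ih _
      · have h_mem : q ∈ {q | O' q ≠ O q} := hq
        refine (toOuterMeasure_le_one _ _).trans ?_
        simp only [Set.indicator_of_mem h_mem, Pi.one_apply, ← add_assoc]
        exact le_add_right le_add_self
    · exact le_self_add

theorem sum_expectedHits_le {ι : Type*} (I : Finset ι) (B : ι → Set (Query V)) (b : ℕ)
    (hb : ∀ q, ∑ i ∈ I, (B i).indicator (1 : Query V → ℝ≥0∞) q ≤ b) (k : ℕ) (m : A.State) :
    ∑ i ∈ I, A.expectedHits O (B i) k m ≤ b * A.expectedHits O Set.univ k m := by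
  induction k generalizing m with
  | zero => simp [expectedHits]
  | succ k ih =>
    simp only [expectedHits]
    rw [← Summable.tsum_finsetSum fun _ _ => ENNReal.summable, ← ENNReal.tsum_mul_left]
    refine ENNReal.tsum_le_tsum fun act => ?_
    rw [← Finset.mul_sum, mul_left_comm]
    gcongr
    rcases act with ⟨m', q⟩ | a
    · simp only [Finset.sum_add_distrib, Set.indicator_univ, Pi.one_apply, mul_add, mul_one]
      gcongr
      · exact hb q
      · rw [← Summable.tsum_finsetSum fun _ _ => ENNReal.summable, ← ENNReal.tsum_mul_left]
        refine ENNReal.tsum_le_tsum fun ans => ?_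
        rw [← Finset.mul_sum, mul_left_comm]
        gcongr
        exact ih _
    · simp

theorem expectedHits_univ (k : ℕ) (m : A.State) :
    A.expectedHits O Set.univ k m = ∑ j ∈ Finset.range k, A.run O j m none := by
  induction k generalizing m with
  | zero => rfl
  | succ k ih =>
    rw [Finset.sum_range_succ']
    simp only [expectedHits, run_zero, run_succ, PMF.bind_apply]
    rw [← Summable.tsum_finsetSum fun _ _ => ENNReal.summable, ← ENNReal.tsum_add]
    refine tsum_congr fun act => ?_
    rw [← Finset.mul_sum, ← mul_add]
    congr 1
    rcases act with ⟨m', q⟩ | a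
    · simp only [Set.indicator_univ, Pi.one_apply, PMF.bind_apply, PMF.pure_apply, if_true]
      rw [← Summable.tsum_finsetSum fun _ _ => ENNReal.summable, add_comm]
      simp only [ih, Finset.mul_sum]
    · simp

theorem expectedHits_univ_le_expectedQueries (k : ℕ) :
    A.expectedHits O Set.univ k A.init ≤ A.expectedQueries O :=
  (A.expectedHits_univ O k A.init).trans_le (ENNReal.sum_le_tsum _)

theorem run_le_run_succ (s : Set α) (k : ℕ) (m : A.State) :
    (A.run O k m).toOuterMeasure (some '' s) ≤
      (A.run O (k + 1) m).toOuterMeasure (some '' s) := by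
  induction k generalizing m with
  | zero =>
    simp only [run_zero, run_succ, PMF.toOuterMeasure_bind_apply]
    refine ENNReal.tsum_le_tsum fun act => mul_le_mul_right ?_ _
    rcases act with ⟨m', q⟩ | a
    · simp [PMF.toOuterMeasure_pure_apply]
    · exact le_rfl
  | succ k ih =>
    rw [run_succ, run_succ A O (k + 1)]
    simp only [PMF.toOuterMeasure_bind_apply]
    refine ENNReal.tsum_le_tsum fun act => mul_le_mul_right ?_ _
    rcases act with ⟨m', q⟩ | a
    · simp only [PMF.toOuterMeasure_bind_apply]
      exact ENNReal.tsum_le_tsum fun ans => mul_le_mul_right (ih _) _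
    · exact le_rfl

theorem run_le_successProb (s : Set α) (k : ℕ) :
    (A.run O k A.init).toOuterMeasure (some '' s) ≤ A.successProb O s :=
  le_iSup (fun k => (A.run O k A.init).toOuterMeasure (some '' s)) k

theorem successProb_mono {s s' : Set α} (h : s ⊆ s') : A.successProb O s ≤ A.successProb O s' :=
  iSup_mono fun _ => MeasureTheory.measure_mono (Set.image_mono h)

theorem successProb_add_le_one {s s' : Set α} (h : Disjoint s s') :
    A.successProb O s + A.successProb O s' ≤ 1 := by
  have hmono (r : Set α) : Monotone fun k => (A.run O k A.init).toOuterMeasure (some '' r) :=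
    monotone_nat_of_le_succ fun k => A.run_le_run_succ O r k _
  rw [successProb, successProb, ENNReal.iSup_add_iSup_of_monotone (hmono s) (hmono s')]
  exact iSup_le fun k => toOuterMeasure_add_le_one _
    ((Set.disjoint_image_iff (Option.some_injective _)).2 h)

theorem successProb_le_third {s s' : Set α} (h : Disjoint s s')
    (hs' : 2 / 3 ≤ A.successProb O s') : A.successProb O s ≤ 1 / 3 := by
  have h_one : (1 / 3 + 2 / 3 : ℝ≥0∞) = 1 := by
    rw [ENNReal.div_add_div_same, show (1 + 2 : ℝ≥0∞) = 3 by norm_num]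
    exact ENNReal.div_self (by norm_num) (by norm_num)
  have h_ne_top : (2 / 3 : ℝ≥0∞) ≠ ⊤ := ENNReal.div_ne_top (by norm_num) (by norm_num)
  refine (ENNReal.add_le_add_iff_right h_ne_top).1 ?_
  rw [h_one]
  exact (add_le_add_right hs' _).trans (A.successProb_add_le_one O h)

variable {O}

-- A hybrid argument: on average over `I`, a run notices the change of oracle with probability at
-- most `b / #I` per query, and separating the oracles costs a total of `1 / 3`.
theorem card_le_mul_expectedQueries {ι : Type*} (I : Finset ι)
    (O' : ι → Query V → PMF (Answer V)) (b : ℕ)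
    (hb : ∀ q, ∑ i ∈ I, {q | O' i q ≠ O q}.indicator (1 : Query V → ℝ≥0∞) q ≤ b)
    {s s' : Set α} (hss : Disjoint s s') (hs : 2 / 3 ≤ A.successProb O s)
    (hs' : ∀ i ∈ I, 2 / 3 ≤ A.successProb (O' i) s') :
    (I.card : ℝ≥0∞) ≤ 3 * (b * A.expectedQueries O) := by
  have h_run (k : ℕ) : (I.card : ℝ≥0∞) * (A.run O k A.init).toOuterMeasure (some '' s) ≤
      I.card * (1 / 3) + b * A.expectedQueries O := by
    calc (I.card : ℝ≥0∞) * (A.run O k A.init).toOuterMeasure (some '' s)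
        = ∑ _i ∈ I, (A.run O k A.init).toOuterMeasure (some '' s) := by simp
      _ ≤ ∑ i ∈ I, (1 / 3 + A.expectedHits O {q | O' i q ≠ O q} k A.init) :=
          Finset.sum_le_sum fun i hi => (A.run_le_run_add_expectedHits O (O' i) _ k _).trans <|
            add_le_add_left ((A.run_le_successProb _ s k).trans
              (A.successProb_le_third _ hss (hs' i hi))) _
      _ = I.card * (1 / 3) + ∑ i ∈ I, A.expectedHits O {q | O' i q ≠ O q} k A.init := by
          simp [Finset.sum_add_distrib]
      _ ≤ I.card * (1 / 3) + b * A.expectedQueries O := by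
          gcongr
          exact (A.sum_expectedHits_le O I _ b hb k _).trans
            (mul_le_mul_right (A.expectedHits_univ_le_expectedQueries O k) _)
  have h_sup : (I.card : ℝ≥0∞) * (2 / 3) ≤ I.card * (1 / 3) + b * A.expectedQueries O := by
    refine (mul_le_mul_right hs _).trans ?_
    rw [successProb, ENNReal.mul_iSup]
    exact iSup_le h_run
  have h_third : (I.card : ℝ≥0∞) * (1 / 3) ≤ b * A.expectedQueries O := by
    have h_two : (2 / 3 : ℝ≥0∞) = 1 / 3 + 1 / 3 := by
      rw [ENNReal.div_add_div_same, one_add_one_eq_two]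
    rw [h_two, mul_add] at h_sup
    exact (ENNReal.add_le_add_iff_left (ENNReal.mul_ne_top (by simp)
      (ENNReal.div_ne_top (by simp) (by simp)))).1 h_sup
  calc (I.card : ℝ≥0∞) = 3 * (I.card * (1 / 3)) := by
        rw [mul_left_comm, ENNReal.mul_div_cancel (by simp) (by simp), mul_one]
    _ ≤ 3 * (b * A.expectedQueries O) := by gcongr

end Algo

end Algorithms

section EffectiveResistance

open scoped Matrix

variable {V : Type} [Fintype V]

section PseudoInverse

variable (A : Matrix V V ℝ) (hA : A.IsHermitian)

open Classical in
theorem pinv_eq_conj : pinv A hA = Unitary.conjStarAlgAut ℝ _ hA.eigenvectorUnitary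
    (Matrix.diagonal fun i => (hA.eigenvalues i)⁻¹) := rfl

open Classical in
theorem conj_diagonal_eigenvalues : Unitary.conjStarAlgAut ℝ _ hA.eigenvectorUnitary
    (Matrix.diagonal hA.eigenvalues) = A := hA.spectral_theorem.symm

theorem pinv_mul_mul_pinv : pinv A hA * A * pinv A hA = pinv A hA := by
  classical
  calc pinv A hA * A * pinv A hA
      = Unitary.conjStarAlgAut ℝ _ hA.eigenvectorUnitary
          ((Matrix.diagonal fun i => (hA.eigenvalues i)⁻¹) * Matrix.diagonal hA.eigenvalues *
            Matrix.diagonal fun i => (hA.eigenvalues i)⁻¹) := by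
        rw [map_mul, map_mul, conj_diagonal_eigenvalues, ← pinv_eq_conj]
    _ = pinv A hA := by
        have h_inv (x : ℝ) : x⁻¹ * x * x⁻¹ = x⁻¹ := by
          simpa only [inv_inv] using mul_inv_mul_cancel x⁻¹
        simp only [Matrix.diagonal_mul_diagonal, h_inv, pinv_eq_conj]

theorem mul_mul_pinv : A * A * pinv A hA = A := by
  classical
  calc A * A * pinv A hA
      = Unitary.conjStarAlgAut ℝ _ hA.eigenvectorUnitary (Matrix.diagonal hA.eigenvalues *
          Matrix.diagonal hA.eigenvalues * Matrix.diagonal fun i => (hA.eigenvalues i)⁻¹) := by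
        rw [map_mul, map_mul, conj_diagonal_eigenvalues, ← pinv_eq_conj]
    _ = Unitary.conjStarAlgAut ℝ _ hA.eigenvectorUnitary (Matrix.diagonal hA.eigenvalues) := by
        simp only [Matrix.diagonal_mul_diagonal, mul_self_mul_inv]
    _ = A := conj_diagonal_eigenvalues A hA

theorem isSymm_pinv : (pinv A hA).IsSymm := by
  classical
  rw [pinv_eq_conj, Matrix.IsSymm, ← Matrix.conjTranspose_eq_transpose_of_trivial,
    ← Matrix.star_eq_conjTranspose, ← map_star, Matrix.star_eq_conjTranspose,
    Matrix.diagonal_conjTranspose, star_trivial]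

end PseudoInverse

variable (G : SimpleGraph V)

open Classical in
/-- The sum of `F` over the darts of `G`, that is, over its edges in both directions; the energy,
the edge boundary and the volume are all expressed in this way. -/
noncomputable def dartSum (F : V → V → ℝ) : ℝ :=
  ∑ p : V × V with G.Adj p.1 p.2, F p.1 p.2

open Classical in
theorem dartSum_eq_sum_sum (F : V → V → ℝ) :
    dartSum G F = ∑ i, ∑ j, if G.Adj i j then F i j else 0 := by
  rw [dartSum, Finset.sum_filter, Fintype.sum_prod_type]

/-- The Dirichlet energy `∑_{uv ∈ E} (f u - f v)²`. -/
noncomputable def energy (f : V → ℝ) : ℝ :=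
  dartSum G (fun i j => (f i - f j) ^ 2) / 2

theorem isSymm_laplacian : (laplacian G).IsSymm := by
  classical
  exact SimpleGraph.isSymm_lapMatrix ℝ G

theorem dotProduct_laplacian_mulVec_self (f : V → ℝ) :
    f ⬝ᵥ (laplacian G).mulVec f = energy G f := by
  classical
  rw [laplacian, energy, dartSum_eq_sum_sum, ← SimpleGraph.lapMatrix_toLinearMap₂',
    Matrix.toLinearMap₂'_apply']

theorem energy_nonneg (f : V → ℝ) : 0 ≤ energy G f := by
  unfold energy dartSum
  positivity

theorem energy_mul_add_const (f : V → ℝ) (a c : ℝ) :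
    energy G (fun i => a * f i + c) = a ^ 2 * energy G f := by
  have h_sq (i j : V) : (a * f i + c - (a * f j + c)) ^ 2 = a ^ 2 * (f i - f j) ^ 2 := by ring
  simp only [energy, dartSum, h_sq, mul_div_assoc', Finset.mul_sum]

open Classical in
/-- The potential `L† (e_s - e_t)` of the unit current from `s` to `t`. -/
noncomputable def potential (s t : V) : V → ℝ :=
  (pinv (laplacian G) (laplacian_isHermitian G)).mulVec (Pi.single s 1 - Pi.single t 1)

variable (s t : V)

theorem effRes_eq_potential_sub : effRes G s t = potential G s t s - potential G s t t := by
  classical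
  rw [effRes, ← potential, sub_dotProduct, single_one_dotProduct, single_one_dotProduct]

theorem effRes_eq_energy_potential : effRes G s t = energy G (potential G s t) := by
  classical
  rw [← dotProduct_laplacian_mulVec_self, potential, Matrix.mulVec_mulVec,
    Matrix.dotProduct_mulVec, ← Matrix.mulVec_transpose, Matrix.mulVec_mulVec]
  rw [Matrix.transpose_mul, isSymm_pinv, isSymm_laplacian, pinv_mul_mul_pinv, dotProduct_comm,
    effRes]

theorem effRes_nonneg : 0 ≤ effRes G s t :=
  (energy_nonneg G _).trans_eq (effRes_eq_energy_potential G s t).symm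

-- Dirichlet's principle: the potential, normalized to the boundary values `1` and `0`, has energy
-- `1 / effRes G s t`.
theorem effRes_le_inv {C : ℝ} (hC : 0 < C)
    (h : ∀ f : V → ℝ, f s = 1 → f t = 0 → C ≤ energy G f) : effRes G s t ≤ C⁻¹ := by
  rcases (effRes_nonneg G s t).eq_or_lt with h_zero | h_pos
  · exact h_zero ▸ (inv_pos.2 hC).le
  set p := potential G s t
  set R := effRes G s t
  have hR : R = p s - p t := effRes_eq_potential_sub G s t
  have h_energy := h (fun i => R⁻¹ * p i + -(R⁻¹ * p t))
    (by rw [← sub_eq_add_neg, ← mul_sub, ← hR, inv_mul_cancel₀ h_pos.ne']) (add_neg_cancel _)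
  rw [energy_mul_add_const, ← effRes_eq_energy_potential, inv_pow, sq, mul_inv,
    inv_mul_cancel_right₀ h_pos.ne'] at h_energy
  exact (le_inv_comm₀ hC h_pos).1 h_energy

variable {G}

open Classical in
theorem laplacian_mulVec_potential (hG : G.Preconnected) :
    (laplacian G).mulVec (potential G s t) = Pi.single s 1 - Pi.single t 1 := by
  set b : V → ℝ := Pi.single s 1 - Pi.single t 1 with hb
  set w : V → ℝ := b - (laplacian G).mulVec (potential G s t) with hw
  have h_ker : (laplacian G).mulVec w = 0 := by
    rw [hw, Matrix.mulVec_sub, potential, Matrix.mulVec_mulVec, Matrix.mulVec_mulVec,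
      mul_mul_pinv, sub_self]
  have h_const (i j : V) : w i = w j :=
    (SimpleGraph.lapMatrix_mulVec_eq_zero_iff_forall_reachable G).1 h_ker i j (hG i j)
  have h_source : b ⬝ᵥ w = 0 := by
    rw [hb, sub_dotProduct, single_dotProduct, single_dotProduct, h_const s t, sub_self]
  have h_range : (laplacian G).mulVec (potential G s t) ⬝ᵥ w = 0 := by
    rw [dotProduct_comm, Matrix.dotProduct_mulVec, ← Matrix.mulVec_transpose, isSymm_laplacian,
      h_ker, zero_dotProduct]
  have h_self : w ⬝ᵥ w = 0 := by
    rw [hw, sub_dotProduct, ← hw, h_source, h_range, sub_zero]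
  exact (sub_eq_zero.1 (dotProduct_self_eq_zero.1 h_self)).symm

-- Cauchy-Schwarz for the Laplacian form, applied to `f` and the potential.
theorem sq_sub_le_effRes_mul_energy (hG : G.Preconnected) (f : V → ℝ) :
    (f s - f t) ^ 2 ≤ effRes G s t * energy G f := by
  classical
  let B : LinearMap.BilinForm ℝ (V → ℝ) := Matrix.toLinearMap₂' ℝ (laplacian G)
  have hB (x y : V → ℝ) : B x y = x ⬝ᵥ (laplacian G).mulVec y :=
    Matrix.toLinearMap₂'_apply' (laplacian G) x y
  have h_self (x : V → ℝ) : B x x = energy G x := by rw [hB, dotProduct_laplacian_mulVec_self]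
  have h_symm : LinearMap.IsSymm B := by
    refine ⟨fun x y => ?_⟩
    rw [RingHom.id_apply, hB, hB, Matrix.dotProduct_mulVec, ← Matrix.mulVec_transpose,
      isSymm_laplacian, dotProduct_comm]
  have h_sub : B f (potential G s t) = f s - f t := by
    rw [hB, laplacian_mulVec_potential s t hG, dotProduct_sub, dotProduct_single_one,
      dotProduct_single_one]
  have h_cauchy := LinearMap.BilinForm.apply_sq_le_of_symm B
    (fun x => (energy_nonneg G x).trans_eq (h_self x).symm) h_symm f (potential G s t)
  rw [h_sub, h_self, h_self, ← effRes_eq_energy_potential] at h_cauchy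
  exact h_cauchy.trans_eq (mul_comm _ _)

end EffectiveResistance

section Conductance

open MeasureTheory

variable {V : Type}

open Classical in
/-- The real-valued indicator function of a vertex set, in terms of which edge boundaries and
volumes become sums over darts. -/
noncomputable def ind (S : Finset V) (v : V) : ℝ :=
  if v ∈ S then 1 else 0

theorem ind_of_mem {S : Finset V} {v : V} (h : v ∈ S) : ind S v = 1 := if_pos h

theorem ind_of_notMem {S : Finset V} {v : V} (h : v ∉ S) : ind S v = 0 := if_neg h

theorem ind_nonneg (S : Finset V) (v : V) : 0 ≤ ind S v := by
  unfold ind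
  positivity

theorem ind_le_one (S : Finset V) (v : V) : ind S v ≤ 1 := by
  unfold ind
  split_ifs <;> norm_num

variable [Fintype V] {G : SimpleGraph V}

theorem sum_ind (S : Finset V) : ∑ v, ind S v = S.card := by
  classical
  simp [ind]

open Classical in
theorem ind_compl (S : Finset V) (v : V) : ind Sᶜ v = 1 - ind S v := by
  by_cases hv : v ∈ S <;> simp [ind, hv]

theorem dartSum_mono {F F' : V → V → ℝ} (h : ∀ i j, G.Adj i j → F i j ≤ F' i j) :
    dartSum G F ≤ dartSum G F' := by
  classical
  exact Finset.sum_le_sum fun p hp => h p.1 p.2 (Finset.mem_filter.1 hp).2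

theorem dartSum_add (F F' : V → V → ℝ) :
    dartSum G (fun i j => F i j + F' i j) = dartSum G F + dartSum G F' :=
  Finset.sum_add_distrib

theorem dartSum_mul (c : ℝ) (F : V → V → ℝ) :
    dartSum G (fun i j => c * F i j) = c * dartSum G F :=
  (Finset.mul_sum ..).symm

theorem dartSum_swap (F : V → V → ℝ) : dartSum G (fun i j => F j i) = dartSum G F := by
  classical
  rw [dartSum_eq_sum_sum, dartSum_eq_sum_sum, Finset.sum_comm]
  simp only [G.adj_comm]

theorem integral_dartSum {F : ℝ → V → V → ℝ} (hF : ∀ i j, Integrable fun t => F t i j) :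
    ∫ t, dartSum G (F t) = dartSum G fun i j => ∫ t, F t i j :=
  integral_finsetSum _ fun _ _ => hF _ _

theorem integrable_dartSum {F : ℝ → V → V → ℝ} (hF : ∀ i j, Integrable fun t => F t i j) :
    Integrable fun t => dartSum G (F t) :=
  integrable_finsetSum _ fun _ _ => hF _ _

open Classical in
theorem dartSum_left (f : V → ℝ) : dartSum G (fun i _ => f i) = ∑ v, G.degree v * f v := by
  rw [dartSum_eq_sum_sum]
  refine Finset.sum_congr rfl fun v _ => ?_
  rw [SimpleGraph.degree_eq_sum_if_adj, Finset.sum_mul]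
  simp only [ite_mul, one_mul, zero_mul]

open Classical in
theorem dartSum_left_of_regular {d : ℕ} (hreg : ∀ v, G.degree v = d) (f : V → ℝ) :
    dartSum G (fun i _ => f i) = d * ∑ v, f v := by
  rw [dartSum_left, Finset.mul_sum]
  simp only [hreg]

theorem cut_eq_dartSum (S : Finset V) :
    (cut G S : ℝ) = dartSum G fun i j => ind S i * (1 - ind S j) := by
  classical
  rw [cut, dartSum, Finset.cast_card, Finset.sum_filter, Finset.sum_filter]
  refine Finset.sum_congr rfl fun p _ => ?_
  by_cases h₁ : p.1 ∈ S <;> by_cases h₂ : p.2 ∈ S <;> simp [ind, h₁, h₂]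

theorem vol_eq_dartSum (S : Finset V) : (vol G S : ℝ) = dartSum G fun i _ => ind S i := by
  classical
  rw [dartSum_left, vol, ← Finset.univ_inter S, ← Finset.sum_ite_mem]
  push_cast
  simp [ind]

open Classical in
theorem cut_compl (S : Finset V) : cut G Sᶜ = cut G S := by
  have h : (cut G Sᶜ : ℝ) = cut G S := by
    simp only [cut_eq_dartSum, ind_compl, sub_sub_cancel]
    rw [← dartSum_swap]
    simp only [mul_comm]
  exact_mod_cast h

open Classical in
theorem vol_compl (S : Finset V) : (vol G Sᶜ : ℝ) = vol G Finset.univ - vol G S := by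
  have h : vol G S + vol G Sᶜ = vol G Finset.univ := Finset.sum_add_sum_compl _ _
  rw [← h, Nat.cast_add, add_sub_cancel_left]

open Classical in
theorem conductance_le_cut_div {S : Finset V} (hS : S.Nonempty) (hS' : Sᶜ.Nonempty) :
    conductance G ≤ cut G S / min (vol G S : ℝ) (vol G Sᶜ : ℝ) :=
  ciInf_le (f := fun S : {S : Finset V // S.Nonempty ∧ Sᶜ.Nonempty} =>
      (cut G S.1 : ℝ) / min (vol G S.1 : ℝ) (vol G (S.1)ᶜ : ℝ))
    ⟨0, by rintro _ ⟨S, rfl⟩; positivity⟩ ⟨S, hS, hS'⟩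

open Classical in
theorem mul_min_vol_le_cut {φ : ℝ} (h : φ ≤ conductance G) (S : Finset V) :
    φ * min (vol G S : ℝ) (vol G Finset.univ - vol G S) ≤ cut G S := by
  rw [← vol_compl]
  have h_nonneg : (0 : ℝ) ≤ min (vol G S : ℝ) (vol G Sᶜ : ℝ) := by positivity
  rcases h_nonneg.eq_or_lt with h_zero | h_pos
  · rw [← h_zero, mul_zero]
    positivity
  · have h_nonempty {T : Finset V} (hT : (0 : ℝ) < vol G T) : T.Nonempty :=
      Finset.nonempty_of_sum_ne_zero (Nat.cast_pos.1 hT).ne'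
    exact (le_div_iff₀ h_pos).1 (h.trans (conductance_le_cut_div
      (h_nonempty (lt_min_iff.1 h_pos).1) (h_nonempty (lt_min_iff.1 h_pos).2)))

open Classical in
theorem mul_min_card_le_cut {d : ℕ} (hreg : ∀ v, G.degree v = d) {φ : ℝ}
    (h : φ ≤ conductance G) (S : Finset V) :
    φ * (d * min (S.card : ℝ) (Fintype.card V - S.card)) ≤ cut G S := by
  have h_cut := mul_min_vol_le_cut h S
  simp only [vol, hreg, Finset.sum_const, smul_eq_mul, Nat.cast_mul] at h_cut
  rwa [← sub_mul, ← min_mul_of_nonneg _ _ (Nat.cast_nonneg d), Finset.card_univ,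
    mul_comm _ (d : ℝ)] at h_cut

open Classical in
-- The cut is invariant under complements, so the sets avoiding one fixed vertex suffice.
theorem le_conductance (hdeg : ∀ v, 0 < G.degree v) {φ : ℝ} (t : V)
    (h : ∀ S : Finset V, t ∉ S → φ * min (vol G S : ℝ) (vol G Finset.univ - vol G S) ≤ cut G S) :
    φ ≤ conductance G := by
  have h_vol {S : Finset V} (hS : S.Nonempty) : (0 : ℝ) < vol G S := by
    exact_mod_cast Finset.sum_pos (fun v _ => hdeg v) hS
  obtain ⟨u, hu⟩ := (G.degree_pos_iff_exists_adj t).1 (hdeg t)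
  have : Nonempty {S : Finset V // S.Nonempty ∧ Sᶜ.Nonempty} :=
    ⟨{t}, Finset.singleton_nonempty t, u, by simpa using hu.ne'⟩
  refine le_ciInf fun ⟨S, hS, hS'⟩ => (le_div_iff₀ (lt_min (h_vol hS) (h_vol hS'))).2 ?_
  simp only [← vol_compl] at h
  by_cases ht : t ∈ S
  · have h_compl := h Sᶜ (by simpa using ht)
    rwa [compl_compl, min_comm, cut_compl] at h_compl
  · exact h S ht

theorem preconnected_of_conductance_pos (h : 0 < conductance G) : G.Preconnected := by
  classical
  intro s t
  by_contra hst
  let S : Finset V := {v | G.Reachable s v}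
  have h_cut : cut G S = 0 := by
    rw [cut, Finset.card_eq_zero, Finset.filter_eq_empty_iff]
    rintro ⟨u, v⟩ - ⟨hu, hv, huv⟩
    simp only [S, Finset.mem_filter, Finset.mem_univ, true_and] at hu hv
    exact hv (hu.trans huv.reachable)
  have h_le := conductance_le_cut_div (G := G) (S := S) ⟨s, by simp [S]⟩ ⟨t, by simpa [S] using hst⟩
  rw [h_cut, Nat.cast_zero, zero_div] at h_le
  exact h.not_ge h_le

-- Both sides are integrals over the levels `t` of a positive function: on the left of the volume of
-- the level set `{h > t}`, on the right of its edge boundary.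
theorem mul_dartSum_le_dartSum_posPart {c : ℝ} {h : V → ℝ} (h_nonneg : ∀ v, 0 ≤ h v)
    (h_cut : ∀ T : Finset V, (∀ v ∈ T, 0 < h v) → c * vol G T ≤ cut G T) :
    c * dartSum G (fun i _ => h i) ≤ dartSum G fun i j => max (h i - h j) 0 := by
  classical
  let I (a b t : ℝ) : ℝ := (Set.Ico a b).indicator 1 t
  have h_int (a b : ℝ) : Integrable (I a b) :=
    (integrable_indicator_iff measurableSet_Ico).2 (integrableOn_const (by simp))
  have h_integral (a b : ℝ) : ∫ t, I a b t = max (b - a) 0 := by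
    rw [integral_indicator_one measurableSet_Ico, Real.volume_real_Ico]
  have h_level (t : ℝ) : c * dartSum G (fun i _ => I 0 (h i) t) ≤
      dartSum G fun i j => I (h j) (h i) t := by
    rcases lt_or_ge t 0 with ht | ht
    · have h_zero (b : ℝ) : I 0 b t = 0 := Set.indicator_of_notMem (fun hm => hm.1.not_gt ht) _
      simp only [h_zero]
      refine le_trans (by simp [dartSum]) (Finset.sum_nonneg fun p _ => ?_)
      exact Set.indicator_nonneg (fun _ _ => zero_le_one) _
    · let T : Finset V := {v | t < h v}
      have h_vol (i : V) : I 0 (h i) t = ind T i := by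
        simp [I, ind, T, Set.indicator_apply, ht]
      have h_boundary (i j : V) : I (h j) (h i) t = ind T i * (1 - ind T j) := by
        by_cases hi : t < h i <;> by_cases hj : t < h j <;>
          simp [I, ind, T, Set.indicator_apply, hi, hj, not_le.2, not_lt.1]
      simp only [h_vol, h_boundary, ← vol_eq_dartSum, ← cut_eq_dartSum]
      exact h_cut T fun v hv => ht.trans_lt (Finset.mem_filter.1 hv).2
  calc c * dartSum G (fun i _ => h i)
      = ∫ t, c * dartSum G fun i _ => I 0 (h i) t := by
        rw [integral_const_mul,
          integral_dartSum (F := fun t i _ => I 0 (h i) t) fun i _ => h_int 0 (h i)]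
        simp only [h_integral, sub_zero, max_eq_left (h_nonneg _)]
    _ ≤ ∫ t, dartSum G fun i j => I (h j) (h i) t :=
        integral_mono ((integrable_dartSum fun i _ => h_int 0 (h i)).const_mul c)
          (integrable_dartSum fun i j => h_int (h j) (h i)) h_level
    _ = dartSum G fun i j => max (h i - h j) 0 := by
        rw [integral_dartSum (F := fun t i j => I (h j) (h i) t) fun i j => h_int (h j) (h i)]
        simp only [h_integral]

-- Cheeger's inequality with Dirichlet boundary conditions: the layer-cake bound for `g ^ 2`.
theorem mul_dartSum_sq_le_energy {c : ℝ} (hc : 0 < c) {g : V → ℝ} (hg : ∀ v, 0 ≤ g v)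
    (h_cut : ∀ T : Finset V, (∀ v ∈ T, 0 < g v) → c * vol G T ≤ cut G T) :
    c ^ 2 / 8 * dartSum G (fun i _ => g i ^ 2) ≤ energy G g := by
  have h_coarea := mul_dartSum_le_dartSum_posPart (h := fun v => g v ^ 2) (fun v => sq_nonneg _)
    fun T hT => h_cut T fun v hv => (hg v).lt_of_ne fun h => by simpa [← h] using hT v hv
  have h_young (i j : V) : max (g i ^ 2 - g j ^ 2) 0 ≤
      2 / c * (g i - g j) ^ 2 + (c / 4 * g i ^ 2 + c / 4 * g j ^ 2) := by
    have h_square : 2 / c * (g i - g j) ^ 2 + (c / 4 * g i ^ 2 + c / 4 * g j ^ 2) -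
        (g i ^ 2 - g j ^ 2) = (4 * (g i - g j) - c * (g i + g j)) ^ 2 / (8 * c) +
          c / 8 * (g i - g j) ^ 2 := by
      field_simp
      ring
    refine max_le (sub_nonneg.1 ?_) (by positivity)
    rw [h_square]
    positivity
  have h_le := h_coarea.trans (dartSum_mono fun i j _ => h_young i j)
  rw [dartSum_add, dartSum_add, dartSum_mul, dartSum_mul, dartSum_mul,
    dartSum_swap fun i _ => g i ^ 2] at h_le
  have h_energy : dartSum G (fun i j => (g i - g j) ^ 2) = 2 * energy G g :=
    (mul_div_cancel₀ _ two_ne_zero).symm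
  rw [h_energy] at h_le
  calc c ^ 2 / 8 * dartSum G (fun i _ => g i ^ 2)
      = c / 4 * (c / 2 * dartSum G fun i _ => g i ^ 2) := by ring
    _ ≤ c / 4 * (2 / c * (2 * energy G g)) :=
        mul_le_mul_of_nonneg_left (by linarith) (by positivity)
    _ = energy G g := by
        field_simp
        ring

open Classical in
theorem cheeger {d : ℕ} (hreg : ∀ v, G.degree v = d) {φ : ℝ} (hφ : 0 < φ)
    (hG : φ ≤ conductance G) {g : V → ℝ} (hg : ∀ v, 0 ≤ g v)
    (hsupp : 2 * (Finset.univ.filter fun v => 0 < g v).card ≤ Fintype.card V) :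
    φ ^ 2 / 8 * d * ∑ v, g v ^ 2 ≤ energy G g := by
  rw [mul_assoc, ← dartSum_left_of_regular hreg]
  refine mul_dartSum_sq_le_energy hφ hg fun T hT => ?_
  have h_card : 2 * T.card ≤ Fintype.card V :=
    (Nat.mul_le_mul_left 2 (Finset.card_le_card fun v hv => by simpa using hT v hv)).trans hsupp
  have h_half : (T.card : ℝ) ≤ Fintype.card V - T.card := by
    have : (2 * T.card : ℝ) ≤ Fintype.card V := by exact_mod_cast h_card
    linarith
  have h_cut := mul_min_card_le_cut hreg hG T
  rwa [min_eq_left h_half, ← sum_ind, ← dartSum_left_of_regular hreg, ← vol_eq_dartSum] at h_cut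

end Conductance

section SourceSink

variable {S₁ S₂ : Type} (H : SimpleGraph S₁) (N₁ : Finset S₁) (N₂ : Finset S₂)

theorem sourceSinkGraph_adj_inl_inl (u v : S₁) :
    (sourceSinkGraph H N₁ N₂).Adj (.inl (.inl u)) (.inl (.inl v)) ↔ H.Adj u v := by
  simp only [sourceSinkGraph, SimpleGraph.fromRel_adj, H.adj_comm v u, or_self, ne_eq,
    Sum.inl.injEq]
  exact ⟨fun h => h.2, fun h => ⟨h.ne, h⟩⟩

theorem sourceSinkGraph_adj_snk (v : S₁ ⊕ S₂) : (sourceSinkGraph H N₁ N₂).Adj snk (.inl v) := by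
  simp [sourceSinkGraph, SimpleGraph.fromRel_adj, snk]

theorem sourceSinkGraph_adj_src_inl (u : S₁) :
    (sourceSinkGraph H N₁ N₂).Adj src (.inl (.inl u)) ↔ u ∈ N₁ := by
  simp [sourceSinkGraph, SimpleGraph.fromRel_adj, src]

theorem sourceSinkGraph_adj_src_inr (w : S₂) :
    (sourceSinkGraph H N₁ N₂).Adj src (.inl (.inr w)) ↔ w ∈ N₂ := by
  simp [sourceSinkGraph, SimpleGraph.fromRel_adj, src]

variable [Fintype S₁] [Fintype S₂]

theorem dartSum_sourceSinkGraph (F : Vert S₁ S₂ → Vert S₁ S₂ → ℝ) :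
    dartSum (sourceSinkGraph H N₁ N₂) F =
      dartSum H (fun u v => F (.inl (.inl u)) (.inl (.inl v))) +
      ∑ u ∈ N₁, (F src (.inl (.inl u)) + F (.inl (.inl u)) src) +
      ∑ w ∈ N₂, (F src (.inl (.inr w)) + F (.inl (.inr w)) src) +
      ∑ u, (F snk (.inl (.inl u)) + F (.inl (.inl u)) snk) +
      ∑ w, (F snk (.inl (.inr w)) + F (.inl (.inr w)) snk) := by
  classical
  simp only [dartSum_eq_sum_sum, Fintype.sum_sum_type, Fintype.sum_bool,
    sourceSinkGraph_adj_inl_inl]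
  simp only [sourceSinkGraph, SimpleGraph.fromRel_adj]
  simp [Finset.sum_add_distrib, src, snk]
  ring

theorem energy_sourceSinkGraph (f : Vert S₁ S₂ → ℝ) :
    energy (sourceSinkGraph H N₁ N₂) f = energy H (fun u => f (.inl (.inl u))) +
      ∑ u ∈ N₁, (f src - f (.inl (.inl u))) ^ 2 + ∑ w ∈ N₂, (f src - f (.inl (.inr w))) ^ 2 +
      ∑ u, (f snk - f (.inl (.inl u))) ^ 2 + ∑ w, (f snk - f (.inl (.inr w))) ^ 2 := by
  have h_double {T : Type} (s : Finset T) (x : ℝ) (y : T → ℝ) :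
      ∑ u ∈ s, ((x - y u) ^ 2 + (y u - x) ^ 2) = 2 * ∑ u ∈ s, (x - y u) ^ 2 := by
    rw [Finset.mul_sum]
    exact Finset.sum_congr rfl fun u _ => by ring
  rw [energy, dartSum_sourceSinkGraph]
  simp only [h_double, energy]
  ring

open Classical in
theorem degree_sourceSinkGraph_pos {N₁ : Finset S₁} {N₂ : Finset S₂}
    (hN : 0 < N₁.card + N₂.card) (v : Vert S₁ S₂) : 0 < (sourceSinkGraph H N₁ N₂).degree v := by
  rw [SimpleGraph.degree_pos_iff_exists_adj]
  have h_src : ∃ v, (sourceSinkGraph H N₁ N₂).Adj src (.inl v) := by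
    rcases add_pos_iff.1 hN with h | h <;> obtain ⟨u, hu⟩ := Finset.card_pos.1 h
    · exact ⟨.inl u, (sourceSinkGraph_adj_src_inl ..).2 hu⟩
    · exact ⟨.inr u, (sourceSinkGraph_adj_src_inr ..).2 hu⟩
  obtain ⟨u, hu⟩ := h_src
  rcases v with v | (_ | _)
  · exact ⟨snk, (sourceSinkGraph_adj_snk H N₁ N₂ v).symm⟩
  · exact ⟨_, hu⟩
  · exact ⟨_, sourceSinkGraph_adj_snk H N₁ N₂ u⟩

section Conductance

variable {H N₁ N₂} (S : Finset (Vert S₁ S₂))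

theorem sum_ind_mem_Icc {V T : Type} [Fintype T] (S : Finset V) (f : T → V) (N : Finset T) :
    ∑ u ∈ N, ind S (f u) ∈ Set.Icc 0 (min (∑ u, ind S (f u)) (N.card : ℝ)) := by
  refine ⟨Finset.sum_nonneg fun u _ => ind_nonneg _ _, le_min ?_ ?_⟩
  · exact Finset.sum_le_sum_of_subset_of_nonneg (Finset.subset_univ N) fun u _ _ => ind_nonneg _ _
  · exact (Finset.sum_le_card_nsmul N _ 1 fun u _ => ind_le_one _ _).trans_eq (by simp)

open Classical in
theorem cut_sourceSinkGraph {S : Finset (Vert S₁ S₂)} (hS : snk ∉ S) :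
    (cut (sourceSinkGraph H N₁ N₂) S : ℝ) =
      cut H {u | Sum.inl (Sum.inl u) ∈ S} +
      ∑ u, ind S (.inl (.inl u)) + ∑ w, ind S (.inl (.inr w)) +
      ind S src * (N₁.card - ∑ u ∈ N₁, ind S (.inl (.inl u)) +
        (N₂.card - ∑ w ∈ N₂, ind S (.inl (.inr w)))) +
      (1 - ind S src) * (∑ u ∈ N₁, ind S (.inl (.inl u)) + ∑ w ∈ N₂, ind S (.inl (.inr w))) := by
  have h_ind (u : S₁) : ind {u | Sum.inl (Sum.inl u) ∈ S} u = ind S (.inl (.inl u)) := by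
    simp [ind]
  rw [cut_eq_dartSum, dartSum_sourceSinkGraph, cut_eq_dartSum]
  simp only [h_ind, ind_of_notMem hS, zero_mul, zero_add, sub_zero, mul_one,
    Finset.sum_add_distrib, ← Finset.mul_sum, ← Finset.sum_mul, Finset.sum_sub_distrib,
    Finset.sum_const, nsmul_eq_mul]
  ring

open Classical in
theorem vol_sourceSinkGraph {d : ℕ} (hreg : ∀ v, H.degree v = d) :
    (vol (sourceSinkGraph H N₁ N₂) S : ℝ) =
      (d + 1) * ∑ u, ind S (.inl (.inl u)) + ∑ w, ind S (.inl (.inr w)) +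
      ∑ u ∈ N₁, ind S (.inl (.inl u)) + ∑ w ∈ N₂, ind S (.inl (.inr w)) +
      ind S src * (N₁.card + N₂.card) + ind S snk * (Fintype.card S₁ + Fintype.card S₂) := by
  rw [vol_eq_dartSum, dartSum_sourceSinkGraph,
    dartSum_left_of_regular hreg fun u => ind S (.inl (.inl u))]
  simp only [Finset.sum_add_distrib, Finset.sum_const, nsmul_eq_mul, Finset.card_univ]
  ring

variable {S} {d : ℕ} {φ : ℝ}

open Classical in
theorem mul_min_le_cut_sourceSinkGraph (hreg : ∀ v, H.degree v = d) (hφ : 0 < φ)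
    (hH : φ ≤ conductance H) (hS : snk ∉ S) :
    d * min (∑ u : S₁, ind S (.inl (.inl u))) (Fintype.card S₁ - ∑ u : S₁, ind S (.inl (.inl u))) ≤
      1 / φ * cut (sourceSinkGraph H N₁ N₂) S := by
  set A : Finset S₁ := {u | Sum.inl (Sum.inl u) ∈ S} with hA
  have h_card : (A.card : ℝ) = ∑ u : S₁, ind S (.inl (.inl u)) := by
    rw [← sum_ind]
    exact Finset.sum_congr rfl fun u _ => by simp [ind, hA]
  have h_cut : (cut H A : ℝ) ≤ cut (sourceSinkGraph H N₁ N₂) S := by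
    obtain ⟨hp, hp'⟩ := sum_ind_mem_Icc S (fun u => .inl (.inl u)) N₁
    obtain ⟨hr, hr'⟩ := sum_ind_mem_Icc S (fun w => .inl (.inr w)) N₂
    rw [le_min_iff] at hp' hr'
    rw [cut_sourceSinkGraph hS]
    have h₁ := mul_nonneg (ind_nonneg S src) (add_nonneg (sub_nonneg.2 hp'.2) (sub_nonneg.2 hr'.2))
    have h₂ := mul_nonneg (sub_nonneg.2 (ind_le_one S src)) (add_nonneg hp hr)
    linarith
  have h_iso := (mul_min_card_le_cut hreg hH A).trans h_cut
  rwa [h_card, ← le_div_iff₀' hφ, ← one_div_mul_eq_div] at h_iso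

open Classical in
-- If `S` contains at most half of `S₁`, the sink edges leaving `S` pay for everything but the
-- edges of `H`, for which the expansion of `H` pays; otherwise the same holds for `Sᶜ`.
theorem min_vol_le_mul_cut_sourceSinkGraph (hreg : ∀ v, H.degree v = d) (hφ : 0 < φ)
    (hH : φ ≤ conductance H) (hN : N₁.card + N₂.card ≤ Fintype.card S₂)
    (hcard : Fintype.card S₂ ≤ Fintype.card S₁) (hS : snk ∉ S) :
    min (vol (sourceSinkGraph H N₁ N₂) S : ℝ)
      (vol (sourceSinkGraph H N₁ N₂) Finset.univ - vol (sourceSinkGraph H N₁ N₂) S) ≤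
      (11 + 1 / φ) * cut (sourceSinkGraph H N₁ N₂) S := by
  have hN' : (N₁.card + N₂.card : ℝ) ≤ Fintype.card S₂ := by exact_mod_cast hN
  have hcard' : (Fintype.card S₂ : ℝ) ≤ Fintype.card S₁ := by exact_mod_cast hcard
  have h_iso := mul_min_le_cut_sourceSinkGraph (N₁ := N₁) (N₂ := N₂) hreg hφ hH hS
  have h_cut := cut_sourceSinkGraph (H := H) (N₁ := N₁) (N₂ := N₂) hS
  have h_vol := vol_sourceSinkGraph (N₁ := N₁) (N₂ := N₂) S hreg
  have h_univ := vol_sourceSinkGraph (N₁ := N₁) (N₂ := N₂) Finset.univ hreg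
  simp only [ind_of_notMem hS, ind_of_mem (Finset.mem_univ _), Finset.sum_const, nsmul_eq_mul,
    mul_one, Finset.card_univ] at h_vol h_univ
  obtain ⟨hp, hp'⟩ := sum_ind_mem_Icc S (fun u => .inl (.inl u)) N₁
  obtain ⟨hr, hr'⟩ := sum_ind_mem_Icc S (fun w => .inl (.inr w)) N₂
  rw [le_min_iff] at hp' hr'
  have h_src : ind S src = 0 ∨ ind S src = 1 := by
    unfold ind
    split_ifs <;> simp
  rcases le_total (∑ u : S₁, ind S (.inl (.inl u)))
    (Fintype.card S₁ - ∑ u : S₁, ind S (.inl (.inl u))) with h | h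
  · rw [min_eq_left h] at h_iso
    refine (min_le_left _ _).trans ?_
    rcases h_src with h | h <;> rw [h] at h_cut h_vol <;> linarith
  · rw [min_eq_right h] at h_iso
    refine (min_le_right _ _).trans ?_
    rcases h_src with h | h <;> rw [h] at h_cut h_vol <;> linarith

open Classical in
theorem le_conductance_sourceSinkGraph (hreg : ∀ v, H.degree v = d) (hφ : 0 < φ)
    (hH : φ ≤ conductance H) (hN₀ : 0 < N₁.card + N₂.card)
    (hN : N₁.card + N₂.card ≤ Fintype.card S₂) (hcard : Fintype.card S₂ ≤ Fintype.card S₁) :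
    1 / (11 + 1 / φ) ≤ conductance (sourceSinkGraph H N₁ N₂) := by
  refine le_conductance (degree_sourceSinkGraph_pos H hN₀) snk fun S hS => ?_
  rw [one_div_mul_eq_div, div_le_iff₀' (by positivity)]
  exact min_vol_le_mul_cut_sourceSinkGraph hreg hφ hH hN hcard hS

end Conductance

end SourceSink

section SourceSinkResistance

variable {S₁ S₂ : Type} [Fintype S₁] [Fintype S₂]

open Classical in
-- The test function is `0` on `S₁` and `1 / 2` on `N₂`.
theorem exists_energy_sourceSinkGraph_eq (H : SimpleGraph S₁) (N₁ : Finset S₁) (N₂ : Finset S₂) :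
    ∃ f : Vert S₁ S₂ → ℝ, f src - f snk = 1 ∧
      energy (sourceSinkGraph H N₁ N₂) f = N₁.card + N₂.card / 2 := by
  refine ⟨Sum.elim (Sum.elim 0 fun w => ind N₂ w / 2) fun b => if b then 0 else 1,
    by simp [src, snk], ?_⟩
  have h_src : ∑ w ∈ N₂, (1 - ind N₂ w / 2) ^ 2 = (N₂.card : ℝ) / 4 := by
    rw [Finset.sum_congr rfl fun w hw => by rw [ind_of_mem hw], Finset.sum_const, nsmul_eq_mul]
    ring
  have h_snk : ∑ w, (0 - ind N₂ w / 2) ^ 2 = (N₂.card : ℝ) / 4 := by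
    rw [← sum_ind, Finset.sum_div]
    refine Finset.sum_congr rfl fun w _ => ?_
    unfold ind
    split_ifs <;> norm_num
  have h_energy : energy H (fun _ => 0) = 0 := by simp [energy, dartSum]
  rw [energy_sourceSinkGraph]
  simp only [src, snk, Sum.elim_inl, Sum.elim_inr, Pi.zero_apply, h_energy, Bool.false_eq_true,
    if_false, if_true, h_src, h_snk]
  simp only [sub_zero, one_pow, Finset.sum_const, nsmul_eq_mul, mul_one, ne_eq, OfNat.ofNat_ne_zero,
    not_false_eq_true, zero_pow, smul_zero]
  ring

theorem inv_le_effRes_sourceSinkGraph {H : SimpleGraph S₁} {N₁ : Finset S₁} {N₂ : Finset S₂}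
    (hN : 0 < N₁.card + N₂.card) (hG : 0 < conductance (sourceSinkGraph H N₁ N₂)) :
    (N₁.card + N₂.card / 2 : ℝ)⁻¹ ≤ effRes (sourceSinkGraph H N₁ N₂) src snk := by
  obtain ⟨f, hf, h_energy⟩ := exists_energy_sourceSinkGraph_eq H N₁ N₂
  have h := sq_sub_le_effRes_mul_energy src snk (preconnected_of_conductance_pos hG) f
  rw [hf, h_energy, one_pow] at h
  have hN' : (0 : ℝ) < N₁.card + N₂.card := by exact_mod_cast hN
  have h_pos : (0 : ℝ) < N₁.card + N₂.card / 2 := by linarith [N₁.card.cast_nonneg (α := ℝ)]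
  exact (inv_le_iff_one_le_mul₀ h_pos).2 h

theorem energy_truncate_le {V : Type} [Fintype V] (G : SimpleGraph V) (f : V → ℝ) (θ : ℝ) :
    energy G (fun v => max (f v - θ) 0) ≤ energy G f := by
  refine div_le_div_of_nonneg_right (dartSum_mono fun i j _ => ?_) zero_le_two
  rw [sq_le_sq]
  simpa using abs_max_sub_max_le_abs (f i - θ) (f j - θ) 0

open Classical in
theorem cheeger_truncate {V : Type} [Fintype V] {G : SimpleGraph V} {d : ℕ}
    (hreg : ∀ v, G.degree v = d) {φ : ℝ} (hφ : 0 < φ) (hG : φ ≤ conductance G) {f : V → ℝ} {θ : ℝ}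
    (hsupp : 2 * (Finset.univ.filter fun v => θ < f v).card ≤ Fintype.card V) :
    φ ^ 2 / 8 * d * ∑ v, max (f v - θ) 0 ^ 2 ≤ energy G f :=
  (cheeger hreg hφ hG (fun _ => le_max_right _ _) (by simpa using hsupp)).trans
    (energy_truncate_le G f θ)

open Classical in
theorem card_filter_lt_mul_sq_le {V : Type} [Fintype V] (f : V → ℝ) {θ : ℝ} (hθ : 0 ≤ θ) :
    (Finset.univ.filter fun v => θ < f v).card * θ ^ 2 ≤ ∑ v, f v ^ 2 := by
  rw [← nsmul_eq_mul]
  refine (Finset.card_nsmul_le_sum _ (fun v => f v ^ 2) _ fun v hv => ?_).trans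
    (Finset.sum_le_sum_of_subset_of_nonneg (Finset.subset_univ _) fun v _ _ => sq_nonneg _)
  exact pow_le_pow_left₀ hθ (Finset.mem_filter.1 hv).2.le 2

theorem one_sub_le_sq_add_mul_truncate_sq {l : ℝ} (hl : 0 < l) (θ x : ℝ) :
    1 - 2 * θ - 1 / l ≤ (1 - x) ^ 2 + l * max (x - θ) 0 ^ 2 := by
  set g := max (x - θ) 0
  have h_le : x - θ ≤ g := le_max_left _ _
  have h_square : l * g ^ 2 - 2 * g + 1 / l = (l * g - 1) ^ 2 / l := by
    field_simp
    ring
  have h_nonneg : 0 ≤ (l * g - 1) ^ 2 / l := by positivity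
  linarith [sq_nonneg x]

open Classical in
-- If the potential is below `1 / d` outside a small set, Cheeger's inequality makes exceeding this
-- threshold at the neighbours of the source expensive; otherwise the last sum is large.
theorem card_mul_le_energy_add_sum_sq {V : Type} [Fintype V] {G : SimpleGraph V} {d : ℕ}
    (hreg : ∀ v, G.degree v = d) {φ : ℝ} (hφ : 0 < φ) (hG : φ ≤ conductance G) (hd : 0 < d)
    (hcard : 2 * d ^ 3 ≤ Fintype.card V) {N : Finset V} (hN : N.card ≤ d) (f : V → ℝ) :
    N.card * (1 - 2 / d - 8 / (d * φ ^ 2)) ≤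
      energy G f + ∑ u ∈ N, (1 - f u) ^ 2 + ∑ u, f u ^ 2 := by
  have h_sum_nonneg : 0 ≤ ∑ u ∈ N, (1 - f u) ^ 2 := by positivity
  rcases le_or_gt (N.card : ℝ) (∑ u, f u ^ 2) with h_big | h_small
  · have h_loss : 0 ≤ (N.card : ℝ) * (2 / d + 8 / (d * φ ^ 2)) := by positivity
    linarith [energy_nonneg G f]
  have : (0 : ℝ) < d := by exact_mod_cast hd
  have h_supp : 2 * (Finset.univ.filter fun u => 1 / (d : ℝ) < f u).card ≤ Fintype.card V := by
    have h_markov := (card_filter_lt_mul_sq_le f (θ := 1 / (d : ℝ)) (by positivity)).trans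
      (h_small.le.trans (Nat.cast_le.2 hN))
    rw [div_pow, one_pow, mul_one_div, div_le_iff₀ (by positivity), ← pow_succ'] at h_markov
    exact (Nat.mul_le_mul_left 2 (by exact_mod_cast h_markov)).trans hcard
  have h_cheeger := cheeger_truncate hreg hφ hG h_supp
  set l : ℝ := φ ^ 2 / 8 * d with hl
  have hl_pos : 0 < l := by positivity
  have h_source : N.card * (1 - 2 * (1 / d) - 1 / l) ≤
      ∑ u ∈ N, (1 - f u) ^ 2 + l * ∑ u ∈ N, max (f u - 1 / d) 0 ^ 2 := by
    rw [← nsmul_eq_mul, Finset.mul_sum, ← Finset.sum_add_distrib]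
    exact Finset.card_nsmul_le_sum _ _ _ fun u _ => one_sub_le_sq_add_mul_truncate_sq hl_pos _ _
  have h_subset : l * ∑ u ∈ N, max (f u - 1 / d) 0 ^ 2 ≤ l * ∑ u, max (f u - 1 / d) 0 ^ 2 :=
    mul_le_mul_of_nonneg_left (Finset.sum_le_sum_of_subset_of_nonneg (Finset.subset_univ _)
      fun v _ _ => sq_nonneg _) hl_pos.le
  have h_eq : (1 - 2 / d - 8 / (d * φ ^ 2) : ℝ) = 1 - 2 * (1 / d) - 1 / l := by
    rw [hl]
    field_simp
  rw [h_eq]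
  have h_sq_nonneg : 0 ≤ ∑ u, f u ^ 2 := by positivity
  linarith

open Classical in
theorem le_energy_sourceSinkGraph {H : SimpleGraph S₁} {d : ℕ} (hreg : ∀ v, H.degree v = d)
    {φ : ℝ} (hφ : 0 < φ) (hH : φ ≤ conductance H) (hd : 0 < d)
    (hcard : 2 * d ^ 3 ≤ Fintype.card S₁) {N₁ : Finset S₁} (hN : N₁.card ≤ d) (N₂ : Finset S₂)
    {f : Vert S₁ S₂ → ℝ} (hs : f src = 1) (ht : f snk = 0) :
    N₁.card * (1 - 2 / d - 8 / (d * φ ^ 2)) ≤ energy (sourceSinkGraph H N₁ N₂) f := by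
  refine (card_mul_le_energy_add_sum_sq hreg hφ hH hd hcard hN fun u => f (.inl (.inl u))).trans ?_
  have h₁ : 0 ≤ ∑ w ∈ N₂, (1 - f (.inl (.inr w))) ^ 2 := by positivity
  have h₂ : 0 ≤ ∑ w : S₂, f (.inl (.inr w)) ^ 2 := by positivity
  rw [energy_sourceSinkGraph, hs, ht]
  simp only [zero_sub, neg_sq]
  linarith

end SourceSinkResistance

section ResistanceGap

variable {S₁ S₂ : Type} [Fintype S₁] [Fintype S₂]

theorem keep_le {ε : ℝ} (hε : ε ≤ 1) (ds : ℕ) : (keep ε ds : ℝ) ≤ (1 - ε) * ds :=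
  Nat.floor_le (mul_nonneg (sub_nonneg.2 hε) ds.cast_nonneg)

theorem keep_le_self {ε : ℝ} (hε : 0 ≤ ε) (ds : ℕ) : keep ε ds ≤ ds :=
  Nat.floor_le_of_le (mul_le_of_le_one_left ds.cast_nonneg (sub_le_self 1 hε))

open Classical in
/-- The part of admissibility on which the resistance gap rests: the logarithmic lower bounds on the
degree are replaced by `ds ≤ d`, and `S₂` only has to be no larger than `S₁`. -/
structure WeaklyAdmissible (φ K ε : ℝ) (H : SimpleGraph S₁) (d ds : ℕ) : Prop where
  regular : ∀ v, H.degree v = d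
  expander : φ ≤ conductance H
  source_large : K / ε ≤ ds
  source_le : ds ≤ Fintype.card S₂
  small : Fintype.card S₂ ≤ Fintype.card S₁
  degree_large : ds ≤ d
  size_large : 2 * d ^ 3 ≤ Fintype.card S₁

theorem Admissible.weaklyAdmissible {φ K ε : ℝ} {H : SimpleGraph S₁} {d ds : ℕ}
    (h : Admissible (S₂ := S₂) φ K ε H d ds) (hε : 0 < ε) (hK : 3 ≤ K) :
    WeaklyAdmissible (S₂ := S₂) φ K ε H d ds := by
  have h_source : (1 : ℝ) ≤ ds := by
    have h_pos : (0 : ℝ) < ds := (div_pos (by linarith) hε).trans_le h.source_large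
    exact_mod_cast h_pos
  have h_card₂ : (1 : ℝ) ≤ Fintype.card S₂ := h_source.trans (Nat.cast_le.2 h.source_le)
  have h_card₁ : 3 * (Fintype.card S₂ : ℝ) ≤ Fintype.card S₁ :=
    (mul_le_mul_of_nonneg_right hK (by positivity)).trans h.small
  have h_log : 1 ≤ Real.log (Fintype.card S₁) := by
    rw [Real.le_log_iff_exp_le (by linarith)]
    linarith [Real.exp_one_lt_d9]
  have h_degree : (ds : ℝ) ≤ d :=
    (le_mul_of_one_le_right ds.cast_nonneg h_log).trans h.degree_large
  have h_small : (Fintype.card S₂ : ℝ) ≤ Fintype.card S₁ := by linarith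
  exact ⟨h.regular, h.expander, h.source_large, h.source_le, by exact_mod_cast h_small,
    by exact_mod_cast h_degree, h.size_large⟩

namespace WeaklyAdmissible

variable {φ K ε : ℝ} {H : SimpleGraph S₁} {d ds : ℕ}

theorem source_pos (h : WeaklyAdmissible (S₂ := S₂) φ K ε H d ds) (hK : 0 < K) (hε : 0 < ε) :
    0 < ds := by
  exact_mod_cast (div_pos hK hε).trans_le h.source_large

theorem one_le_mul (h : WeaklyAdmissible (S₂ := S₂) φ K ε H d ds) (hε : 0 < ε) (hK : 1 ≤ K) :
    1 ≤ ε * ds :=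
  hK.trans ((div_le_iff₀' hε).1 h.source_large)

theorem le_conductance_of_mem_family₁ (h : WeaklyAdmissible (S₂ := S₂) φ K ε H d ds) (hK : 0 < K)
    (hφ : 0 < φ) (hε : 0 < ε) {G : SimpleGraph (Vert S₁ S₂)} (hG : G ∈ Family₁ S₂ H ds) :
    1 / (11 + 1 / φ) ≤ conductance G := by
  obtain ⟨N₁, rfl, rfl⟩ := hG
  exact le_conductance_sourceSinkGraph h.regular hφ h.expander (by simpa using h.source_pos hK hε)
    (by simpa using h.source_le) h.small

theorem le_conductance_of_mem_family₂ (h : WeaklyAdmissible (S₂ := S₂) φ K ε H d ds) (hK : 0 < K)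
    (hφ : 0 < φ) (hε : 0 < ε) {G : SimpleGraph (Vert S₁ S₂)} (hG : G ∈ Family₂ S₂ H ε ds) :
    1 / (11 + 1 / φ) ≤ conductance G := by
  obtain ⟨N₁, N₂, h₁, h₂, rfl⟩ := hG
  have h_card : N₁.card + N₂.card = ds := by
    rw [h₁, h₂, Nat.add_sub_cancel' (keep_le_self hε.le ds)]
  exact le_conductance_sourceSinkGraph h.regular hφ h.expander
    (h_card ▸ h.source_pos hK hε) (h_card ▸ h.source_le) h.small

theorem loss_le (h : WeaklyAdmissible (S₂ := S₂) φ K ε H d ds) (hφ : 0 < φ) (hε : 0 < ε)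
    (hK : 16 + 64 / φ ^ 2 ≤ K) : 2 / d + 8 / (d * φ ^ 2) ≤ ε / 8 := by
  have hK_pos : 0 < K := lt_of_lt_of_le (by positivity) hK
  have hd : (0 : ℝ) < d := Nat.cast_pos.2 ((h.source_pos hK_pos hε).trans_le h.degree_large)
  have h_large : K / ε ≤ d := h.source_large.trans (Nat.cast_le.2 h.degree_large)
  calc 2 / d + 8 / (d * φ ^ 2) = (16 + 64 / φ ^ 2) / d / 8 := by
        field_simp
        ring
    _ ≤ K / d / 8 := by gcongr
    _ ≤ ε / 8 := div_le_div_of_nonneg_right ((div_le_comm₀ hε hd).1 h_large) (by norm_num)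

theorem effRes_le_of_mem_family₁ (h : WeaklyAdmissible (S₂ := S₂) φ K ε H d ds) (hφ : 0 < φ)
    (hε : 0 < ε) (hε' : ε < 1) (hK : 16 + 64 / φ ^ 2 ≤ K) {G : SimpleGraph (Vert S₁ S₂)}
    (hG : G ∈ Family₁ S₂ H ds) : effRes G src snk ≤ (ds * (1 - ε / 8))⁻¹ := by
  obtain ⟨N₁, h_card, rfl⟩ := hG
  have hK_pos : 0 < K := lt_of_lt_of_le (by positivity) hK
  have hds := h.source_pos hK_pos hε
  refine effRes_le_inv _ _ _ (mul_pos (Nat.cast_pos.2 hds) (by linarith)) fun f hs ht => ?_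
  refine le_trans ?_ (le_energy_sourceSinkGraph h.regular hφ h.expander
    (hds.trans_le h.degree_large) h.size_large (h_card.trans_le h.degree_large) ∅ hs ht)
  rw [h_card]
  exact mul_le_mul_of_nonneg_left (by linarith [h.loss_le hφ hε hK]) ds.cast_nonneg

theorem le_effRes_of_mem_family₂ (h : WeaklyAdmissible (S₂ := S₂) φ K ε H d ds) (hφ : 0 < φ)
    (hε : 0 < ε) (hε' : ε ≤ 1) (hK : 0 < K) {G : SimpleGraph (Vert S₁ S₂)}
    (hG : G ∈ Family₂ S₂ H ε ds) : (ds * (1 - ε / 2))⁻¹ ≤ effRes G src snk := by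
  have h_cond : 0 < conductance G :=
    lt_of_lt_of_le (by positivity) (h.le_conductance_of_mem_family₂ hK hφ hε hG)
  obtain ⟨N₁, N₂, h₁, h₂, rfl⟩ := hG
  have h_keep := keep_le_self hε.le ds
  have h_card : N₁.card + N₂.card = ds := by rw [h₁, h₂, Nat.add_sub_cancel' h_keep]
  have h_pos : 0 < N₁.card + N₂.card := h_card ▸ h.source_pos hK hε
  refine le_trans ?_ (inv_le_effRes_sourceSinkGraph h_pos h_cond)
  have h_pos' : (0 : ℝ) < N₁.card + N₂.card := by exact_mod_cast h_pos
  refine inv_anti₀ (by linarith [N₁.card.cast_nonneg (α := ℝ)]) ?_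
  rw [h₁, h₂, Nat.cast_sub h_keep]
  linarith [keep_le hε' ds]

theorem mul_effRes_lt_effRes (h : WeaklyAdmissible (S₂ := S₂) φ K ε H d ds) (hφ : 0 < φ)
    (hε : 0 < ε) (hε' : ε < 1) (hK : 16 + 64 / φ ^ 2 ≤ K) {G₁ G₂ : SimpleGraph (Vert S₁ S₂)}
    (hG₁ : G₁ ∈ Family₁ S₂ H ds) (hG₂ : G₂ ∈ Family₂ S₂ H ε ds) :
    (1 + ε / 4) * effRes G₁ src snk < effRes G₂ src snk := by
  have hK_pos : 0 < K := lt_of_lt_of_le (by positivity) hK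
  have hds : (0 : ℝ) < ds := Nat.cast_pos.2 (h.source_pos hK_pos hε)
  have h_lt : (1 + ε / 4) * (1 - ε / 2) < 1 - ε / 8 := by nlinarith
  calc (1 + ε / 4) * effRes G₁ src snk ≤ (1 + ε / 4) * (ds * (1 - ε / 8))⁻¹ :=
        mul_le_mul_of_nonneg_left (h.effRes_le_of_mem_family₁ hφ hε hε' hK hG₁) (by linarith)
    _ < (ds * (1 - ε / 2))⁻¹ := by
        rw [← div_eq_mul_inv, ← one_div, div_lt_div_iff₀ (mul_pos hds (by linarith))
          (mul_pos hds (by linarith)), one_mul, mul_left_comm]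
        exact mul_lt_mul_of_pos_left h_lt hds
    _ ≤ effRes G₂ src snk := h.le_effRes_of_mem_family₂ hφ hε hε'.le hK_pos hG₂

end WeaklyAdmissible

end ResistanceGap

section AdjacencyLists

open Classical in
/-- The `i`-th entry of the adjacency list of `v`, if there is one: the answer to a neighbour
query. -/
noncomputable def listEntry {V : Type} [Fintype V] {G : SimpleGraph V} (σ : AdjLists G) (v : V)
    (i : ℕ) : Option V :=
  if h : i < G.degree v then some (σ v ⟨i, h⟩ : V) else none

variable {V : Type} [Fintype V] {G : SimpleGraph V} (σ : AdjLists G)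

theorem oracle_neighbor [Nonempty V] (v : V) (i : ℕ) :
    oracle G σ (.neighbor v i) = PMF.pure (.vertex (listEntry σ v i)) := rfl

open Classical in
theorem nonempty_adjLists (G : SimpleGraph V) : Nonempty (AdjLists G) :=
  ⟨fun v => Fintype.equivOfCardEq <| by
    rw [SimpleGraph.card_neighborSet_eq_degree, Fintype.card_fin]⟩

open Classical in
theorem exists_ordering_of_bijOn {G' : SimpleGraph V} {v : V} {f : V → V}
    (hf : Set.BijOn f (G.neighborSet v) (G'.neighborSet v)) :
    G'.degree v = G.degree v ∧ ∃ e : Fin (G'.degree v) ≃ G'.neighborSet v,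
      ∀ i (h' : i < G'.degree v) (h : i < G.degree v), (e ⟨i, h'⟩ : V) = f (σ v ⟨i, h⟩) := by
  have hd : G'.degree v = G.degree v := by
    rw [← SimpleGraph.card_neighborSet_eq_degree, ← SimpleGraph.card_neighborSet_eq_degree]
    exact (Fintype.card_congr hf.equiv).symm
  exact ⟨hd, (finCongr hd).trans ((σ v).trans hf.equiv), fun i _ _ => rfl⟩

open Classical in
theorem exists_adjLists_of_bijOn (G' : SimpleGraph V) (f : V → V → V) :
    ∃ σ' : AdjLists G', ∀ v, Set.BijOn (f v) (G.neighborSet v) (G'.neighborSet v) →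
      G'.degree v = G.degree v ∧ ∀ i, listEntry σ' v i = (listEntry σ v i).map (f v) := by
  obtain ⟨τ⟩ := nonempty_adjLists G'
  have hex (v : V) : ∃ e : Fin (G'.degree v) ≃ G'.neighborSet v,
      Set.BijOn (f v) (G.neighborSet v) (G'.neighborSet v) → G'.degree v = G.degree v ∧
        ∀ i (h' : i < G'.degree v) (h : i < G.degree v), (e ⟨i, h'⟩ : V) = f v (σ v ⟨i, h⟩) := by
    by_cases hv : Set.BijOn (f v) (G.neighborSet v) (G'.neighborSet v)
    · obtain ⟨hd, e, he⟩ := exists_ordering_of_bijOn σ hv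
      exact ⟨e, fun _ => ⟨hd, he⟩⟩
    · exact ⟨τ v, fun h => absurd h hv⟩
  choose σ' hσ' using hex
  refine ⟨σ', fun v hv => ?_⟩
  obtain ⟨hd, he⟩ := hσ' v hv
  refine ⟨hd, fun i => ?_⟩
  by_cases hi : i < G.degree v
  · simp only [listEntry]
    rw [dif_pos hi, dif_pos (hd ▸ hi), Option.map_some, he i _ hi]
  · simp only [listEntry]
    rw [dif_neg hi, dif_neg (hd ▸ hi), Option.map_none]

end AdjacencyLists

section Swap

variable {S₁ S₂ : Type}

theorem sourceSinkGraph_adj_src_iff {H : SimpleGraph S₁} {N₁ : Finset S₁} {N₂ : Finset S₂}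
    {v : Vert S₁ S₂} : (sourceSinkGraph H N₁ N₂).Adj src v ↔
      (∃ u ∈ N₁, v = .inl (.inl u)) ∨ ∃ w ∈ N₂, v = .inl (.inr w) := by
  rcases v with (u | w) | (_ | _) <;> simp [src, sourceSinkGraph, SimpleGraph.fromRel_adj]

open Classical in
/-- Moving the neighbours `u ∈ X` of the source to the vertices `g u` of `S₂`. -/
noncomputable def redirect (X : Finset S₁) (g : S₁ → S₂) : Vert S₁ S₂ → Vert S₁ S₂
  | .inl (.inl u) => .inl (if u ∈ X then .inr (g u) else .inl u)
  | v => v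

open Classical in
theorem bijOn_redirect (H : SimpleGraph S₁) {N₁ X : Finset S₁} {g : S₁ → S₂} (hX : X ⊆ N₁)
    (hg : Set.InjOn g X) :
    Set.BijOn (redirect X g) ((sourceSinkGraph H N₁ ∅).neighborSet src)
      ((sourceSinkGraph H (N₁ \ X) (X.image g)).neighborSet src) := by
  have hN₁ {v : Vert S₁ S₂} : (sourceSinkGraph H N₁ ∅).Adj src v ↔ ∃ u ∈ N₁, v = .inl (.inl u) := by
    simp [sourceSinkGraph_adj_src_iff]
  refine ⟨fun v hv => ?_, fun v hv v' hv' h => ?_, fun v hv => ?_⟩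
  · obtain ⟨u, hu, rfl⟩ := hN₁.1 hv
    by_cases huX : u ∈ X
    · simpa [redirect, huX, sourceSinkGraph_adj_src_inr] using ⟨u, huX, rfl⟩
    · simp [redirect, huX, sourceSinkGraph_adj_src_inl, hu]
  · obtain ⟨u, -, rfl⟩ := hN₁.1 hv
    obtain ⟨u', -, rfl⟩ := hN₁.1 hv'
    by_cases hu : u ∈ X <;> by_cases hu' : u' ∈ X <;>
      simp only [redirect, hu, hu', if_true, if_false, Sum.inl.injEq, Sum.inr.injEq,
        reduceCtorEq] at h
    · rw [hg hu hu' h]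
    · rw [h]
  · obtain ⟨u, hu, rfl⟩ | ⟨w, hw, rfl⟩ := sourceSinkGraph_adj_src_iff.1 hv
    · rw [Finset.mem_sdiff] at hu
      exact ⟨.inl (.inl u), hN₁.2 ⟨u, hu.1, rfl⟩, by simp [redirect, hu.2]⟩
    · obtain ⟨u, hu, rfl⟩ := Finset.mem_image.1 hw
      exact ⟨.inl (.inl u), hN₁.2 ⟨u, hX hu, rfl⟩, by simp [redirect, hu]⟩

open Classical in
theorem neighborSet_sourceSinkGraph_swap (H : SimpleGraph S₁) (N₁ : Finset S₁) {X : Finset S₁}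
    {g : S₁ → S₂} {v : Vert S₁ S₂} (hv : v ≠ src)
    (hX : ∀ u ∈ X, v ≠ .inl (.inl u) ∧ v ≠ .inl (.inr (g u))) :
    (sourceSinkGraph H (N₁ \ X) (X.image g)).neighborSet v =
      (sourceSinkGraph H N₁ ∅).neighborSet v := by
  ext x
  rw [SimpleGraph.mem_neighborSet, SimpleGraph.mem_neighborSet]
  rcases v with (u | w) | (_ | _)
  · have hu : u ∈ N₁ \ X ↔ u ∈ N₁ := by
      rw [Finset.mem_sdiff, and_iff_left fun hu => (hX u hu).1 rfl]
    rcases x with (_ | _) | (_ | _) <;> simp only [sourceSinkGraph, SimpleGraph.fromRel_adj, hu]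
  · have hw : w ∈ X.image g ↔ w ∈ (∅ : Finset S₂) := by
      refine iff_of_false (fun hw => ?_) (Finset.notMem_empty w)
      obtain ⟨u, hu, rfl⟩ := Finset.mem_image.1 hw
      exact (hX u hu).2 rfl
    rcases x with (_ | _) | (_ | _) <;> simp only [sourceSinkGraph, SimpleGraph.fromRel_adj, hw]
  · exact absurd rfl hv
  · rcases x with (_ | _) | (_ | _) <;> simp only [sourceSinkGraph, SimpleGraph.fromRel_adj]

variable [Fintype S₁] [Fintype S₂] {H : SimpleGraph S₁} {N₁ : Finset S₁}

/-- The queries whose answer may change when the neighbour `u` of the source is moved to `g u`. -/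
def Probes (σ : AdjLists (sourceSinkGraph H N₁ (∅ : Finset S₂))) (g : S₁ → S₂) (u : S₁) :
    Query (Vert S₁ S₂) → Prop
  | .degree v => v = .inl (.inl u) ∨ v = .inl (.inr (g u))
  | .neighbor v i => v = .inl (.inl u) ∨ v = .inl (.inr (g u)) ∨
      v = src ∧ listEntry σ src i = some (.inl (.inl u))
  | .jump => False

variable {σ : AdjLists (sourceSinkGraph H N₁ (∅ : Finset S₂))} {g : S₁ → S₂}

theorem Probes.eq (hg : Set.InjOn g N₁) {u u' : S₁} (hu : u ∈ N₁) (hu' : u' ∈ N₁)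
    {q : Query (Vert S₁ S₂)} (h : Probes σ g u q) (h' : Probes σ g u' q) : u = u' := by
  have := fun h => hg hu hu' h
  cases q <;> simp only [Probes] at h h' <;> grind [src]

open Classical in
theorem exists_oracle_swap_eq {X : Finset S₁} (hX : X ⊆ N₁) (hg : Set.InjOn g X) :
    ∃ σ' : AdjLists (sourceSinkGraph H (N₁ \ X) (X.image g)),
      ∀ q, (∀ u ∈ X, ¬ Probes σ g u q) → oracle _ σ' q = oracle _ σ q := by
  obtain ⟨σ', hσ'⟩ := exists_adjLists_of_bijOn σ (sourceSinkGraph H (N₁ \ X) (X.image g))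
    fun v => if v = src then redirect X g else id
  have hsrc := hσ' src (by simpa using bijOn_redirect H hX hg)
  have hother {v} (hv : v ≠ src) (hvX : ∀ u ∈ X, v ≠ .inl (.inl u) ∧ v ≠ .inl (.inr (g u))) :=
    hσ' v (by
      rw [if_neg hv, neighborSet_sourceSinkGraph_swap H N₁ hv hvX]
      exact Set.bijOn_id _)
  refine ⟨σ', ?_⟩
  rintro (v | ⟨v, i⟩ | _) hq
  · have hdeg : (sourceSinkGraph H (N₁ \ X) (X.image g)).degree v =
        (sourceSinkGraph H N₁ ∅).degree v := by
      by_cases hv : v = src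
      · rw [hv, hsrc.1]
      · exact (hother hv fun u hu => not_or.1 (hq u hu)).1
    rw [oracle, hdeg, oracle]
  · suffices h : listEntry σ' v i = listEntry σ v i by rw [oracle_neighbor, oracle_neighbor, h]
    by_cases hv : v = src
    · subst hv
      rw [hsrc.2, if_pos rfl]
      cases hx : listEntry σ src i with
      | none => rfl
      | some x =>
        rcases x with (u | w) | _
        · have hu : u ∉ X := fun hu => hq u hu (.inr (.inr ⟨rfl, hx⟩))
          simp [redirect, hu]
        · rfl
        · rfl
    · rw [(hother hv fun u hu => ⟨fun h => hq u hu (.inl h), fun h => hq u hu (.inr (.inl h))⟩).2,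
        if_neg hv, Option.map_id_apply]
  · rfl

end Swap

section SwapLowerBound

variable {S₁ S₂ : Type} [Fintype S₁] [Fintype S₂] {H : SimpleGraph S₁} {N₁ : Finset S₁}
  {σ : AdjLists (sourceSinkGraph H N₁ (∅ : Finset S₂))} {g : S₁ → S₂}

open Classical in
theorem card_filter_probes_le (hg : Set.InjOn g N₁) (b : ℕ) (q : Query (Vert S₁ S₂)) :
    ((N₁.powersetCard (b + 1)).filter fun X => ∃ u ∈ X, Probes σ g u q).card ≤
      (N₁.card - 1).choose b := by
  by_cases hq : ∃ u ∈ N₁, Probes σ g u q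
  · obtain ⟨u, hu, huq⟩ := hq
    calc _ ≤ ((N₁.powersetCard (b + 1)).filter ({u} ⊆ ·)).card := by
          refine Finset.card_le_card fun X hX => ?_
          obtain ⟨hX, u', hu', hu'q⟩ := Finset.mem_filter.1 hX
          have hu'N := (Finset.mem_powersetCard.1 hX).1 hu'
          rw [Finset.mem_filter, Finset.singleton_subset_iff, Probes.eq hg hu hu'N huq hu'q]
          exact ⟨hX, hu'⟩
      _ = (N₁.card - 1).choose b := by
          rw [Finset.card_filter_powersetCard_subset _ _ _ (Finset.singleton_subset_iff.2 hu)
            (by simp), Finset.card_singleton, Nat.add_sub_cancel]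
  · rw [Finset.filter_false_of_mem, Finset.card_empty]
    · exact Nat.zero_le _
    · rintro X hX ⟨u, hu, huq⟩
      exact hq ⟨u, (Finset.mem_powersetCard.1 hX).1 hu, huq⟩

open Classical in
-- Averaging over all sets `X` of `b + 1` moved neighbours: each query notices only the sets that
-- contain one particular neighbour, a fraction `(b + 1) / N₁.card` of them.
theorem card_le_mul_expectedQueries_of_swap (hcard : N₁.card ≤ Fintype.card S₂) {b : ℕ}
    (hb : b < N₁.card) {α : Type} (A : Algo (Vert S₁ S₂) α) {s s' : Set α} (hss : Disjoint s s')
    (hs : 2 / 3 ≤ A.successProb (oracle _ σ) s)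
    (hs' : ∀ N₁' : Finset S₁, N₁'.card = N₁.card - (b + 1) → ∀ N₂ : Finset S₂, N₂.card = b + 1 →
      ∀ σ' : AdjLists (sourceSinkGraph H N₁' N₂), 2 / 3 ≤ A.successProb (oracle _ σ') s') :
    (N₁.card : ℝ≥0∞) ≤ 3 * ((b + 1 : ℕ) * A.expectedQueries (oracle _ σ)) := by
  obtain ⟨m, hm⟩ : ∃ m, N₁.card = m + 1 := Nat.exists_eq_add_one.2 (by omega)
  obtain ⟨g, hg⟩ : ∃ g : S₁ → S₂, Set.InjOn g N₁ := by
    have : Nonempty S₂ := Fintype.card_pos_iff.1 (by omega)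
    obtain ⟨g⟩ : Nonempty (N₁ ↪ S₂) := Function.Embedding.nonempty_of_card_le (by simpa using hcard)
    exact Set.exists_injOn_iff_injective.2 ⟨g, g.injective⟩
  have : Nonempty (Query (Vert S₁ S₂) → PMF (Answer (Vert S₁ S₂))) := ⟨oracle _ σ⟩
  have hO' : ∀ X ∈ N₁.powersetCard (b + 1), ∃ O', 2 / 3 ≤ A.successProb O' s' ∧
      ∀ q, (∀ u ∈ X, ¬ Probes σ g u q) → O' q = oracle _ σ q := by
    intro X hX
    rw [Finset.mem_powersetCard] at hX
    obtain ⟨σ', hσ'⟩ := exists_oracle_swap_eq (σ := σ) hX.1 (hg.mono hX.1)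
    refine ⟨oracle _ σ', hs' _ ?_ _ ?_ σ', hσ'⟩
    · rw [Finset.card_sdiff_of_subset hX.1, hX.2]
    · rw [Finset.card_image_of_injOn (hg.mono hX.1), hX.2]
  choose! O' hsO' hO' using hO'
  have hchoose := A.card_le_mul_expectedQueries (N₁.powersetCard (b + 1)) O'
    ((N₁.card - 1).choose b) (O := oracle _ σ) (fun q => ?_) hss hs hsO'
  · rw [Finset.card_powersetCard, hm, Nat.add_sub_cancel] at hchoose
    have hpos : (m.choose b : ℝ≥0∞) ≠ 0 := by
      exact_mod_cast (Nat.choose_pos (by omega : b ≤ m)).ne'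
    refine (ENNReal.mul_le_mul_iff_left hpos (ENNReal.natCast_ne_top _)).1 ?_
    calc (N₁.card : ℝ≥0∞) * m.choose b = (b + 1 : ℕ) * (m + 1).choose (b + 1) := by
          rw [hm]; exact_mod_cast (Nat.add_one_mul_choose_eq m b).trans (mul_comm _ _)
      _ ≤ (b + 1 : ℕ) * (3 * (m.choose b * A.expectedQueries (oracle _ σ))) := by gcongr
      _ = 3 * ((b + 1 : ℕ) * A.expectedQueries (oracle _ σ)) * m.choose b := by ring
  · refine le_trans ?_ (Nat.cast_le.2 (card_filter_probes_le (σ := σ) hg b q))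
    rw [Finset.card_filter, Nat.cast_sum]
    refine Finset.sum_le_sum fun X hX => Set.indicator_apply_le' (fun hq => ?_) fun _ => zero_le
    have : ∃ u ∈ X, Probes σ g u q := by
      by_contra! h
      exact hq (hO' X hX q h)
    simp [this]

theorem ofReal_le_of_natCast_le_mul {n b : ℕ} {ε : ℝ} {T : ℝ≥0∞} (hε : 0 < ε) (hn : 0 < n)
    (hb : (b : ℝ) ≤ 2 * ε * n) (hT : (n : ℝ≥0∞) ≤ 3 * (b * T)) :
    ENNReal.ofReal (1 / 6 / ε) ≤ T := by
  rcases eq_or_ne T ⊤ with rfl | htop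
  · exact le_top
  refine ENNReal.ofReal_le_of_le_toReal ((div_le_iff₀ hε).2 ?_)
  have hn' : (0 : ℝ) < n := Nat.cast_pos.2 hn
  have hreal : (n : ℝ) ≤ 3 * (b * T.toReal) := by
    simpa using ENNReal.toReal_mono (by finiteness) hT
  have hbT : b * T.toReal ≤ 2 * ε * n * T.toReal :=
    mul_le_mul_of_nonneg_right hb ENNReal.toReal_nonneg
  have : 1 * (n : ℝ) ≤ 6 * (T.toReal * ε) * n := by linarith
  linarith [le_of_mul_le_mul_right this hn']

theorem ofReal_le_expectedQueries_of_separates {ε : ℝ} {ds : ℕ} (hε : 0 < ε) (hds : 1 ≤ ε * ds)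
    (hcard : ds ≤ Fintype.card S₂) (hN : N₁.card = ds) {α : Type} (A : Algo (Vert S₁ S₂) α)
    {s s' : Set α} (hss : Disjoint s s') (hs : 2 / 3 ≤ A.successProb (oracle _ σ) s)
    (hs' : ∀ G ∈ Family₂ S₂ H ε ds, ∀ σ' : AdjLists G, 2 / 3 ≤ A.successProb (oracle G σ') s') :
    ENNReal.ofReal (1 / 6 / ε) ≤ A.expectedQueries (oracle _ σ) := by
  have hds₀ : 0 < ds := by
    by_contra! h
    rw [Nat.le_zero.1 h] at hds
    norm_num at hds
  have hkeep : keep ε ds < ds := (Nat.floor_lt' hds₀.ne').2 (by linarith)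
  obtain ⟨b, hb⟩ : ∃ b, ds - keep ε ds = b + 1 := Nat.exists_eq_add_one.2 (by omega)
  have hbε : ((b + 1 : ℕ) : ℝ) ≤ 2 * ε * ds := by
    have : (1 - ε) * ds < keep ε ds + 1 := Nat.lt_floor_add_one _
    rw [← hb, Nat.cast_sub hkeep.le]
    linarith
  refine ofReal_le_of_natCast_le_mul hε hds₀ hbε ?_
  subst hN
  refine card_le_mul_expectedQueries_of_swap hcard (by omega) A hss hs fun N₁' h₁ N₂ h₂ => ?_
  exact hs' _ ⟨N₁', N₂, by omega, by omega, rfl⟩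

end SwapLowerBound

section L1Gap

open SimpleGraph

variable {α β V : Type} [Fintype α] [Fintype β] [Fintype V]

/-- The `ℓ¹` Poincaré inequality with constant `κ`: the total difference of a function over all
pairs is at most `κ` times that over the adjacent pairs. Unlike conductance, it passes to box
products. -/
def L1Gap (G : SimpleGraph V) (κ : ℝ) : Prop :=
  ∀ f : V → ℝ, ∑ x, ∑ y, |f x - f y| ≤ κ * dartSum G fun x y => |f x - f y|

theorem l1Gap_top : L1Gap (⊤ : SimpleGraph V) 1 := by
  classical
  intro f
  rw [one_mul, dartSum_eq_sum_sum]
  refine Finset.sum_le_sum fun x _ => Finset.sum_le_sum fun y _ => ?_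
  by_cases h : x = y <;> simp [h]

theorem dartSum_boxProd (G : SimpleGraph α) (H : SimpleGraph β) (F : α × β → α × β → ℝ) :
    dartSum (G □ H) F = ∑ b, dartSum G (fun a a' => F (a, b) (a', b)) +
      ∑ a, dartSum H (fun b b' => F (a, b) (a, b')) := by
  classical
  have hpt : ∀ x y : α × β, (if (G □ H).Adj x y then F x y else 0) =
      (if x.2 = y.2 then (if G.Adj x.1 y.1 then F x y else 0) else 0) +
        if x.1 = y.1 then (if H.Adj x.2 y.2 then F x y else 0) else 0 := by
    rintro ⟨a, b⟩ ⟨a', b'⟩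
    by_cases h₁ : a = a' <;> by_cases h₂ : b = b' <;> simp [boxProd_adj, h₁, h₂]
  simp only [dartSum_eq_sum_sum, hpt, Finset.sum_add_distrib, Fintype.sum_prod_type]
  congr 1
  · rw [Finset.sum_comm]
    simp
  · refine Finset.sum_congr rfl fun a _ => Finset.sum_congr rfl fun b _ => ?_
    rw [Finset.sum_comm]
    simp

theorem L1Gap.boxProd {G : SimpleGraph α} {H : SimpleGraph β} {κ₁ κ₂ κ : ℝ} (hG : L1Gap G κ₁)
    (hH : L1Gap H κ₂) (h₁ : Fintype.card β * κ₁ ≤ κ) (h₂ : Fintype.card α * κ₂ ≤ κ) :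
    L1Gap (G □ H) κ := by
  intro f
  have dartSum_nonneg {V : Type} [Fintype V] (G : SimpleGraph V) (f : V → ℝ) :
      0 ≤ dartSum G fun x y => |f x - f y| :=
    Finset.sum_nonneg fun _ _ => abs_nonneg _
  rw [dartSum_boxProd, Fintype.sum_prod_type]
  simp only [Fintype.sum_prod_type]
  calc ∑ a, ∑ b, ∑ a', ∑ b', |f (a, b) - f (a', b')|
      ≤ ∑ a, ∑ b, ∑ a', ∑ b', (|f (a, b) - f (a', b)| + |f (a', b) - f (a', b')|) := by
        gcongr
        exact abs_sub_le _ _ _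
    _ = Fintype.card β * ∑ b, ∑ a, ∑ a', |f (a, b) - f (a', b)| +
        Fintype.card α * ∑ a', ∑ b, ∑ b', |f (a', b) - f (a', b')| := by
        simp only [Finset.sum_add_distrib, Finset.sum_const, Finset.card_univ, nsmul_eq_mul]
        congr 1
        · rw [Finset.sum_comm]
          simp only [Finset.mul_sum]
        · congr 1
          rw [Finset.sum_comm]
    _ ≤ Fintype.card β * (κ₁ * ∑ b, dartSum G fun a a' => |f (a, b) - f (a', b)|) +
        Fintype.card α * (κ₂ * ∑ a, dartSum H fun b b' => |f (a, b) - f (a, b')|) := by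
        rw [Finset.mul_sum (a := κ₁), Finset.mul_sum (a := κ₂)]
        gcongr with b _ a _
        · exact hG fun a => f (a, b)
        · exact hH fun b => f (a, b)
    _ ≤ κ * ∑ b, dartSum G (fun a a' => |f (a, b) - f (a', b)|) +
        κ * ∑ a, dartSum H (fun b b' => |f (a, b) - f (a, b')|) := by
        rw [← mul_assoc, ← mul_assoc]
        gcongr
        · exact Finset.sum_nonneg fun b _ => dartSum_nonneg G fun a => f (a, b)
        · exact Finset.sum_nonneg fun a _ => dartSum_nonneg H fun b => f (a, b)
    _ = _ := (mul_add ..).symm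

theorem abs_ind_sub_ind {V : Type} (S : Finset V) (x y : V) :
    |ind S x - ind S y| = ind S x * (1 - ind S y) + ind S y * (1 - ind S x) := by
  by_cases hx : x ∈ S <;> by_cases hy : y ∈ S <;> simp [ind, hx, hy]

theorem dartSum_abs_ind_sub_ind (G : SimpleGraph V) (S : Finset V) :
    dartSum G (fun x y => |ind S x - ind S y|) = 2 * cut G S := by
  simp only [abs_ind_sub_ind]
  rw [dartSum_add, dartSum_swap fun x y => ind S x * (1 - ind S y), ← cut_eq_dartSum, two_mul]

theorem L1Gap.card_mul_card_le {G : SimpleGraph V} {κ : ℝ} (h : L1Gap G κ) (S : Finset V) :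
    S.card * (Fintype.card V - S.card) ≤ κ * cut G S := by
  have hsum : ∑ x, ∑ y, |ind S x - ind S y| = 2 * (S.card * (Fintype.card V - S.card)) := by
    simp only [abs_ind_sub_ind, Finset.sum_add_distrib, ← Finset.mul_sum, ← Finset.sum_mul,
      Finset.sum_sub_distrib, sum_ind, Finset.sum_const, Finset.card_univ, nsmul_eq_mul]
    ring
  have hgap := h (ind S)
  rw [hsum, dartSum_abs_ind_sub_ind] at hgap
  linarith

open Classical in
theorem L1Gap.le_conductance [Nonempty V] {G : SimpleGraph V} {d : ℕ}
    (hreg : ∀ v, G.degree v = d) (hd : 0 < d) {κ φ : ℝ} (hκ : 0 < κ) (h : L1Gap G κ)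
    (hφ : φ * (2 * κ * d) ≤ Fintype.card V) : φ ≤ conductance G := by
  obtain ⟨t⟩ := ‹Nonempty V›
  refine ERLower.le_conductance (fun v => hd.trans_eq (hreg v).symm) t fun S _ => ?_
  have hmin (x n : ℝ) (hx : 0 ≤ x) (hxn : x ≤ n) : n * min x (n - x) ≤ 2 * (x * (n - x)) := by
    rcases min_cases x (n - x) with ⟨h, h'⟩ | ⟨h, h'⟩ <;> rw [h] <;> nlinarith
  have hS : (S.card : ℝ) ≤ Fintype.card V := Nat.cast_le.2 S.card_le_univ
  have : 0 ≤ min (S.card : ℝ) (Fintype.card V - S.card) :=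
    le_min S.card.cast_nonneg (sub_nonneg.2 hS)
  simp only [vol, hreg, Finset.sum_const, smul_eq_mul, Nat.cast_mul, Finset.card_univ]
  rw [← sub_mul, ← min_mul_of_nonneg _ _ d.cast_nonneg]
  refine le_of_mul_le_mul_left ?_ (mul_pos two_pos hκ)
  calc 2 * κ * (φ * (min (S.card : ℝ) (Fintype.card V - S.card) * d))
      = φ * (2 * κ * d) * min (S.card : ℝ) (Fintype.card V - S.card) := by ring
    _ ≤ Fintype.card V * min (S.card : ℝ) (Fintype.card V - S.card) := by gcongr
    _ ≤ 2 * (S.card * (Fintype.card V - S.card)) := hmin _ _ S.card.cast_nonneg hS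
    _ ≤ 2 * (κ * cut G S) := mul_le_mul_of_nonneg_left (h.card_mul_card_le S) zero_le_two
    _ = 2 * κ * cut G S := by ring

end L1Gap

section Hamming

open SimpleGraph Filter

/-- The Hamming graph on words of length four over an alphabet with `q` letters. Length four makes
the number `q ^ 4` of vertices exceed twice the cube of the degree `4 * (q - 1)`. -/
def hamming (q : ℕ) : SimpleGraph ((Fin q × Fin q) × Fin q × Fin q) :=
  ((⊤ : SimpleGraph (Fin q)) □ (⊤ : SimpleGraph (Fin q))) □
    ((⊤ : SimpleGraph (Fin q)) □ (⊤ : SimpleGraph (Fin q)))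

theorem card_hamming (q : ℕ) : Fintype.card ((Fin q × Fin q) × Fin q × Fin q) = q ^ 4 := by
  simp only [Fintype.card_prod, Fintype.card_fin]
  ring

open Classical in
theorem degree_hamming (q : ℕ) (v : (Fin q × Fin q) × Fin q × Fin q) :
    (hamming q).degree v = 4 * (q - 1) := by
  have h : (hamming q).degree v = (q - 1 + (q - 1)) + (q - 1 + (q - 1)) := by
    rw [hamming, degree_boxProd, degree_boxProd, degree_boxProd]
    simp only [complete_graph_degree, Fintype.card_fin]
  omega

theorem l1Gap_hamming (q : ℕ) : L1Gap (hamming q) ((q : ℝ) ^ 3) := by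
  have h : L1Gap ((⊤ : SimpleGraph (Fin q)) □ (⊤ : SimpleGraph (Fin q))) (q : ℝ) :=
    l1Gap_top.boxProd l1Gap_top (by simp) (by simp)
  have hcard : (Fintype.card (Fin q × Fin q) : ℝ) * q = q ^ 3 := by
    simp only [Fintype.card_prod, Fintype.card_fin, Nat.cast_mul]
    ring
  exact h.boxProd h hcard.le hcard.le

theorem le_conductance_hamming {q : ℕ} (hq : 2 ≤ q) : 1 / 8 ≤ conductance (hamming q) := by
  have : NeZero q := ⟨by omega⟩
  refine (l1Gap_hamming q).le_conductance (degree_hamming q) (by omega) (by positivity) ?_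
  rw [card_hamming, Nat.cast_mul, Nat.cast_sub (by omega)]
  push_cast
  linarith [show (0 : ℝ) ≤ q ^ 3 by positivity]

theorem eventually_mul_log_pow_le (C : ℝ) (k : ℕ) :
    ∀ᶠ n : ℕ in atTop, C * Real.log n ^ k ≤ n := by
  have h := ((Real.isLittleO_pow_log_id_atTop (n := k)).const_mul_left C).bound one_pos
  filter_upwards [tendsto_natCast_atTop_atTop.eventually h] with n hn
  rw [one_mul, id_eq, Real.norm_natCast] at hn
  exact (le_abs_self _).trans hn

theorem admissible_hamming {K ε : ℝ} {q ds : ℕ} (hq : 128 ≤ q) (hds : K / ε ≤ ds)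
    (hK : K * ds ≤ q) (hlog : 2 * ds * Real.log q ^ 1 ≤ q) (hlog_sq : 8 * Real.log q ^ 2 ≤ q) :
    Admissible (S₂ := Fin ds) (1 / 8) K ε (hamming q) (4 * (q - 1)) ds := by
  have hqR : (128 : ℝ) ≤ q := by exact_mod_cast hq
  have hd : ((4 * (q - 1) : ℕ) : ℝ) = 4 * (q - 1) := by
    rw [Nat.cast_mul, Nat.cast_sub (by omega), Nat.cast_ofNat, Nat.cast_one]
  have hlog_card : Real.log (Fintype.card ((Fin q × Fin q) × Fin q × Fin q)) =
      4 * Real.log q := by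
    rw [card_hamming, Nat.cast_pow, Real.log_pow, Nat.cast_ofNat]
  refine ⟨degree_hamming q, le_conductance_hamming (by omega), hds, by simp, ?_, ?_, ?_, ?_⟩
  · rw [card_hamming, Fintype.card_fin]
    exact hK.trans (by exact_mod_cast Nat.le_self_pow four_ne_zero q)
  · rw [hlog_card, hd]
    linarith
  · rw [hlog_card, hd]
    linarith
  · rw [card_hamming]
    calc 2 * (4 * (q - 1)) ^ 3 ≤ 2 * (4 * q) ^ 3 := by gcongr; exact q.sub_le 1
      _ = 128 * q ^ 3 := by ring
      _ ≤ q * q ^ 3 := by gcongr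
      _ = q ^ 4 := by ring

theorem exists_admissible_hamming (K ε : ℝ) (N : ℕ) :
    ∃ q ds : ℕ, N ≤ Fintype.card ((Fin q × Fin q) × Fin q × Fin q) ∧
      Admissible (S₂ := Fin ds) (1 / 8) K ε (hamming q) (4 * (q - 1)) ds := by
  obtain ⟨ds, hds⟩ := exists_nat_ge (K / ε)
  obtain ⟨q, hq, hN, hK, hlog, hlog_sq⟩ := ((eventually_ge_atTop 128).and <|
    (eventually_ge_atTop N).and <|
    (tendsto_natCast_atTop_atTop.eventually_ge_atTop (K * ds)).and <|
    (eventually_mul_log_pow_le (2 * ds) 1).and <| eventually_mul_log_pow_le 8 2).exists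
  refine ⟨q, ds, ?_, admissible_hamming hq hds hK hlog hlog_sq⟩
  rw [card_hamming]
  exact hN.trans (Nat.le_self_pow four_ne_zero q)

end Hamming

section Separation

variable {V : Type} [Fintype V] [Nonempty V] {φ ε : ℝ} {s t : V} {A : Algo V ℝ}
  {G : SimpleGraph V}

theorem ApproximatesER.le_successProb_Iic (hA : ApproximatesER φ ε s t A) (σ : AdjLists G)
    (hG : φ ≤ conductance G) :
    2 / 3 ≤ A.successProb (oracle G σ) (Set.Iic ((1 + ε) * effRes G s t)) :=
  (hA G σ hG).trans (A.successProb_mono _ fun _ hx => hx.2)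

theorem ApproximatesER.le_successProb_Ioi (hA : ApproximatesER φ ε s t A) (σ : AdjLists G)
    (hG : φ ≤ conductance G) {y : ℝ} (hy : y < (1 - ε) * effRes G s t) :
    2 / 3 ≤ A.successProb (oracle G σ) (Set.Ioi y) :=
  (hA G σ hG).trans (A.successProb_mono _ fun _ hx => hy.trans_le hx.1)

end Separation

theorem Algo.inv_three_le_expectedQueries {V α : Type} (A : Algo V α)
    {O O' : Query V → PMF (Answer V)} {s s' : Set α} (hss : Disjoint s s')
    (hs : 2 / 3 ≤ A.successProb O s) (hs' : 2 / 3 ≤ A.successProb O' s') :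
    3⁻¹ ≤ A.expectedQueries O := by
  have h := A.card_le_mul_expectedQueries (O := O) {()} (fun _ => O') 1
    (fun q => by simpa using Set.indicator_le_self' (f := (1 : Query V → ℝ≥0∞)) (by simp) q)
    hss hs fun _ _ => hs'
  rw [ENNReal.inv_le_iff_le_mul (by simp) (by simp)]
  simpa using h

section Approximation

variable {S₁ S₂ : Type} [Fintype S₁] [Fintype S₂] {φ K δ ε : ℝ} {H : SimpleGraph S₁} {d ds : ℕ}
  {G : SimpleGraph (Vert S₁ S₂)}

namespace WeaklyAdmissible

theorem ofReal_le_expectedQueries_of_approximatesER_of_small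
    (h : WeaklyAdmissible (S₂ := S₂) φ K (16 * ε) H d ds) (hφ : 0 < φ) (hK : 16 + 64 / φ ^ 2 ≤ K)
    (hε : 0 < ε) (hε' : 16 * ε < 1) (hG : G ∈ Family₁ S₂ H ds) {A : Algo (Vert S₁ S₂) ℝ}
    (hA : ApproximatesER (1 / (11 + 1 / φ)) ε src snk A) (σ : AdjLists G) :
    ENNReal.ofReal (1 / 96 / ε) ≤ A.expectedQueries (oracle G σ) := by
  have hK₁ : 1 ≤ K := by linarith [show 0 ≤ 64 / φ ^ 2 by positivity]
  have hK₀ : 0 < K := by linarith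
  have h16 : 0 < 16 * ε := by linarith
  have hcond := h.le_conductance_of_mem_family₁ hK₀ hφ h16 hG
  have hsep (G₂) (hG₂ : G₂ ∈ Family₂ S₂ H (16 * ε) ds) :
      (1 + ε) * effRes G src snk < (1 - ε) * effRes G₂ src snk :=
    calc (1 + ε) * effRes G src snk ≤ (1 - ε) * ((1 + 16 * ε / 4) * effRes G src snk) := by
          rw [← mul_assoc]
          exact mul_le_mul_of_nonneg_right (by nlinarith) (effRes_nonneg G src snk)
      _ < (1 - ε) * effRes G₂ src snk :=
          mul_lt_mul_of_pos_left (h.mul_effRes_lt_effRes hφ h16 hε' hK hG hG₂) (by linarith)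
  have hds : 1 ≤ 16 * ε * ds := h.one_le_mul h16 hK₁
  obtain ⟨N₁, hN₁, rfl⟩ := hG
  rw [show 1 / 96 / ε = 1 / 6 / (16 * ε) by ring]
  exact ofReal_le_expectedQueries_of_separates h16 hds h.source_le hN₁ A
    (Set.Iic_disjoint_Ioi le_rfl) (hA.le_successProb_Iic σ hcond) fun G₂ hG₂ σ' =>
      hA.le_successProb_Ioi σ' (h.le_conductance_of_mem_family₂ hK₀ hφ h16 hG₂) (hsep G₂ hG₂)

-- The comparison graph gives the source a single neighbour, so that its resistance is at least `1`.
theorem inv_three_le_expectedQueries_of_approximatesER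
    (h : WeaklyAdmissible (S₂ := S₂) φ K δ H d ds) (hφ : 0 < φ) (hK : 16 + 64 / φ ^ 2 ≤ K)
    (hδ : 0 < δ) (hδ' : δ < 1) (hε : 0 < ε) (hε' : ε < 1) (hds : 4 ≤ (1 - ε) * ds)
    (hG : G ∈ Family₁ S₂ H ds) {A : Algo (Vert S₁ S₂) ℝ}
    (hA : ApproximatesER (1 / (11 + 1 / φ)) ε src snk A) (σ : AdjLists G) :
    3⁻¹ ≤ A.expectedQueries (oracle G σ) := by
  have hK₀ : 0 < K := lt_of_lt_of_le (by positivity) hK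
  have hds₀ : 0 < ds := h.source_pos hK₀ hδ
  have hdsR : (0 : ℝ) < ds := Nat.cast_pos.2 hds₀
  have hcond := h.le_conductance_of_mem_family₁ hK₀ hφ hδ hG
  have hupper : (1 + ε) * effRes G src snk < 1 - ε :=
    calc (1 + ε) * effRes G src snk ≤ (1 + ε) * (ds * (1 - δ / 8))⁻¹ :=
          mul_le_mul_of_nonneg_left (h.effRes_le_of_mem_family₁ hφ hδ hδ' hK hG) (by linarith)
      _ < 1 - ε := by
          rw [← div_eq_mul_inv, div_lt_iff₀ (mul_pos hdsR (by linarith))]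
          nlinarith
  obtain ⟨u⟩ : Nonempty S₁ :=
    Fintype.card_pos_iff.1 (hds₀.trans_le (h.source_le.trans h.small))
  have hcond' : 1 / (11 + 1 / φ) ≤ conductance (sourceSinkGraph H {u} (∅ : Finset S₂)) :=
    le_conductance_sourceSinkGraph h.regular hφ h.expander (by simp)
      (by simpa using Nat.succ_le_of_lt (hds₀.trans_le h.source_le)) h.small
  have hlower : 1 ≤ effRes (sourceSinkGraph H {u} (∅ : Finset S₂)) src snk := by
    simpa using inv_le_effRes_sourceSinkGraph (H := H) (N₁ := {u}) (N₂ := (∅ : Finset S₂))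
      (by simp) (lt_of_lt_of_le (by positivity) hcond')
  obtain ⟨σ'⟩ := nonempty_adjLists (sourceSinkGraph H {u} (∅ : Finset S₂))
  exact A.inv_three_le_expectedQueries (Set.Iic_disjoint_Ioi le_rfl)
    (hA.le_successProb_Iic σ hcond)
    (hA.le_successProb_Ioi σ' hcond'
      (hupper.trans_le (le_mul_of_one_le_right (by linarith) hlower)))

theorem ofReal_le_expectedQueries_of_approximatesER
    (h : WeaklyAdmissible (S₂ := S₂) φ K (min (16 * ε) (1 / 2)) H d ds) (hφ : 0 < φ)
    (hK : 16 + 64 / φ ^ 2 ≤ K) (hε : 0 < ε) (hε' : ε < 1) (hds : 4 ≤ (1 - ε) * ds)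
    (hG : G ∈ Family₁ S₂ H ds) {A : Algo (Vert S₁ S₂) ℝ}
    (hA : ApproximatesER (1 / (11 + 1 / φ)) ε src snk A) (σ : AdjLists G) :
    ENNReal.ofReal (1 / 96 / ε) ≤ A.expectedQueries (oracle G σ) := by
  rcases le_total (16 * ε) (1 / 2) with hle | hge
  · rw [min_eq_left hle] at h
    exact h.ofReal_le_expectedQueries_of_approximatesER_of_small hφ hK hε (by linarith) hG hA σ
  · rw [min_eq_right hge] at h
    calc ENNReal.ofReal (1 / 96 / ε) ≤ 3⁻¹ := by
          refine ENNReal.ofReal_le_of_le_toReal ((div_le_iff₀ hε).2 ?_)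
          rw [ENNReal.toReal_inv, ENNReal.toReal_ofNat]
          linarith
      _ ≤ A.expectedQueries (oracle G σ) :=
          h.inv_three_le_expectedQueries_of_approximatesER hφ hK (by norm_num) (by norm_num) hε
            hε' hds hG hA σ

end WeaklyAdmissible

theorem exists_ofReal_le_expectedQueries_of_approximatesER (hε : 0 < ε) (hε' : ε < 1) (N : ℕ) :
    ∃ (V : Type) (_ : Fintype V) (_ : Nonempty V) (G : SimpleGraph V) (s t : V),
      N ≤ Fintype.card V ∧ 1 / 19 ≤ conductance G ∧
      ∀ A : Algo V ℝ, ApproximatesER (1 / 19) ε s t A → ∀ σ : AdjLists G,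
        ENNReal.ofReal (1 / 96 / ε) ≤ A.expectedQueries (oracle G σ) := by
  have hε₀ : 0 < 1 - ε := sub_pos.2 hε'
  have hφ : (0 : ℝ) < 1 / 8 := by norm_num
  have hδ : 0 < min (16 * ε) (1 / 2) := lt_min (by linarith) (by norm_num)
  have hδ' : min (16 * ε) (1 / 2) ≤ 1 := (min_le_right _ _).trans (by norm_num)
  set K := 16 + 64 / (1 / 8 : ℝ) ^ 2 + 4 / (1 - ε)
  have hK : 16 + 64 / (1 / 8 : ℝ) ^ 2 ≤ K := le_add_of_nonneg_right (by positivity)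
  have hK₀ : 0 < K := by positivity
  obtain ⟨q, ds, hN, hadm⟩ := exists_admissible_hamming K (min (16 * ε) (1 / 2)) N
  have h := hadm.weaklyAdmissible hδ (by linarith)
  have hds : 4 ≤ (1 - ε) * ds :=
    (div_le_iff₀' hε₀).1 <| calc 4 / (1 - ε) ≤ K := le_add_of_nonneg_left (by norm_num)
      _ ≤ K / min (16 * ε) (1 / 2) := le_div_self hK₀.le hδ hδ'
      _ ≤ ds := h.source_large
  obtain ⟨N₁, -, hN₁⟩ := Finset.exists_subset_card_eq (h.source_le.trans h.small)
  have hG : sourceSinkGraph (hamming q) N₁ ∅ ∈ Family₁ (Fin ds) (hamming q) ds := ⟨N₁, hN₁, rfl⟩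
  rw [show (1 / 19 : ℝ) = 1 / (11 + 1 / (1 / 8)) by norm_num]
  refine ⟨_, inferInstance, inferInstance, sourceSinkGraph (hamming q) N₁ (∅ : Finset (Fin ds)),
    src, snk, hN.trans ?_, h.le_conductance_of_mem_family₁ hK₀ hφ hδ hG,
    fun A hA σ => h.ofReal_le_expectedQueries_of_approximatesER hφ hK hε hε' hds hG hA σ⟩
  simp only [Fintype.card_sum]
  omega

theorem ofReal_le_expectedQueries_of_distinguishes (hε : 0 < ε) (hds : 1 ≤ ε * ds)
    (hcard : ds ≤ Fintype.card S₂) {A : Algo (Vert S₁ S₂) Bool}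
    (hA : Distinguishes (Family₁ S₂ H ds) (Family₂ S₂ H ε ds) A) (hG : G ∈ Family₁ S₂ H ds)
    (σ : AdjLists G) : ENNReal.ofReal (1 / 6 / ε) ≤ A.expectedQueries (oracle G σ) := by
  have hs := hA.1 G hG σ
  obtain ⟨N₁, hN₁, rfl⟩ := hG
  exact ofReal_le_expectedQueries_of_separates hε hds hcard hN₁ A (by simp) hs hA.2

end Approximation

end ERLower

open ERLower in
theorem theorem2_general :
    (∀ ε : ℝ, 0 < ε → ε < 1 → ∀ N : ℕ,
      ∃ (V : Type) (_ : Fintype V) (_ : Nonempty V) (G : SimpleGraph V) (s t : V),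
        N ≤ Fintype.card V ∧ 1 / 19 ≤ conductance G ∧
        ∀ A : Algo V ℝ, ApproximatesER (1 / 19) ε s t A → ∀ σ : AdjLists G,
          ENNReal.ofReal (1 / 96 / ε) ≤ A.expectedQueries (oracle G σ)) ∧
    (∀ φ ε : ℝ, 0 < φ → 0 < ε → ε < 1 →
      ∀ (S₁ S₂ : Type) [Fintype S₁] [Fintype S₂] (H : SimpleGraph S₁) (d ds : ℕ),
        WeaklyAdmissible (S₂ := S₂) φ (16 + 64 / φ ^ 2) ε H d ds →
        ∀ G₁ ∈ Family₁ S₂ H ds, ∀ G₂ ∈ Family₂ S₂ H ε ds,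
          1 / (11 + 1 / φ) ≤ conductance G₁ ∧ 1 / (11 + 1 / φ) ≤ conductance G₂ ∧
          ε / 4 * effRes G₁ src snk < |effRes G₁ src snk - effRes G₂ src snk|) ∧
    (∀ ε : ℝ, 0 < ε →
      ∀ (S₁ S₂ : Type) [Fintype S₁] [Fintype S₂] (H : SimpleGraph S₁) (ds : ℕ),
        1 ≤ ε * ds → ds ≤ Fintype.card S₂ →
        ∀ A : Algo (Vert S₁ S₂) Bool, Distinguishes (Family₁ S₂ H ds) (Family₂ S₂ H ε ds) A →
        ∀ G₁ ∈ Family₁ S₂ H ds, ∀ σ : AdjLists G₁,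
          ENNReal.ofReal (1 / 6 / ε) ≤ A.expectedQueries (oracle G₁ σ)) ∧
    (∀ K ε : ℝ, 0 < ε → ∀ N : ℕ,
      ∃ (S₁ S₂ : Type) (_ : Fintype S₁) (_ : Fintype S₂) (H : SimpleGraph S₁) (d ds : ℕ),
        N ≤ Fintype.card S₁ ∧ Admissible (S₂ := S₂) (1 / 8) K ε H d ds) := by
  refine ⟨fun _ hε hε' N => exists_ofReal_le_expectedQueries_of_approximatesER hε hε' N,
    fun φ ε hφ hε hε' S₁ S₂ _ _ H d ds h G₁ hG₁ G₂ hG₂ => ?_,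
    fun ε hε S₁ S₂ _ _ H ds hds hcard A hA G₁ hG₁ σ =>
      ofReal_le_expectedQueries_of_distinguishes hε hds hcard hA hG₁ σ, fun K ε _ N => ?_⟩
  · have hK : 0 < 16 + 64 / φ ^ 2 := by positivity
    have hgap := h.mul_effRes_lt_effRes hφ hε hε' le_rfl hG₁ hG₂
    refine ⟨h.le_conductance_of_mem_family₁ hK hφ hε hG₁,
      h.le_conductance_of_mem_family₂ hK hφ hε hG₂, lt_abs.2 (Or.inr ?_)⟩
    linarith
  · obtain ⟨q, ds, hN, h⟩ := exists_admissible_hamming K ε N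
    exact ⟨_, Fin ds, inferInstance, inferInstance, hamming q, 4 * (q - 1), ds, hN, h⟩

theorem theorem2 :
    (∃ φ c : ℝ, 0 < φ ∧ 0 < c ∧ ∀ ε : ℝ, 0 < ε → ε < 1 → ∀ N : ℕ,
      ∃ (V : Type) (_ : Fintype V) (_ : Nonempty V) (G : SimpleGraph V) (s t : V),
        N ≤ Fintype.card V ∧ φ ≤ ERLower.conductance G ∧
        ∀ A : ERLower.Algo V ℝ, ERLower.ApproximatesER φ ε s t A →
          ∀ σ : ERLower.AdjLists G,
            ENNReal.ofReal (c / ε) ≤ A.expectedQueries (ERLower.oracle G σ)) ∧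
    (∃ c : ℝ, 0 < c ∧ ∀ φ : ℝ, 0 < φ → ∃ K φ' : ℝ, 0 < K ∧ 0 < φ' ∧
      ∀ ε : ℝ, 0 < ε → ε < 1 →
      ∀ (S₁ S₂ : Type) [Fintype S₁] [Fintype S₂] (H : SimpleGraph S₁) (d ds : ℕ),
        ERLower.Admissible (S₂ := S₂) φ K ε H d ds →
        (∀ G₁ ∈ ERLower.Family₁ S₂ H ds, ∀ G₂ ∈ ERLower.Family₂ S₂ H ε ds,
          φ' ≤ ERLower.conductance G₁ ∧ φ' ≤ ERLower.conductance G₂ ∧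
          ε / 4 * ERLower.effRes G₁ ERLower.src ERLower.snk <
            |ERLower.effRes G₁ ERLower.src ERLower.snk -
              ERLower.effRes G₂ ERLower.src ERLower.snk|) ∧
        (∀ A : ERLower.Algo (ERLower.Vert S₁ S₂) Bool,
          ERLower.Distinguishes (ERLower.Family₁ S₂ H ds) (ERLower.Family₂ S₂ H ε ds) A →
          ∀ G₁ ∈ ERLower.Family₁ S₂ H ds, ∀ σ : ERLower.AdjLists G₁,
            ENNReal.ofReal (c / ε) ≤ A.expectedQueries (ERLower.oracle G₁ σ))) ∧
    (∃ φ : ℝ, 0 < φ ∧ ∀ K ε : ℝ, 0 < K → 0 < ε → ε < 1 → ∀ N : ℕ,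
      ∃ (S₁ S₂ : Type) (_ : Fintype S₁) (_ : Fintype S₂) (H : SimpleGraph S₁) (d ds : ℕ),
        N ≤ Fintype.card S₁ ∧ ERLower.Admissible (S₂ := S₂) φ K ε H d ds) := by
  obtain ⟨hard, gap, separation, admissible⟩ := theorem2_general
  refine ⟨⟨1 / 19, 1 / 96, by norm_num, by norm_num, hard⟩, ⟨1 / 6, by norm_num, fun φ hφ =>
    ⟨16 + 64 / φ ^ 2, 1 / (11 + 1 / φ), by positivity, by positivity,
      fun ε hε hε' S₁ S₂ _ _ H d ds h => ?_⟩⟩,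
    ⟨1 / 8, by norm_num, fun K ε _ hε _ => admissible K ε hε⟩⟩
  have hK : 3 ≤ 16 + 64 / φ ^ 2 := by linarith [show 0 ≤ 64 / φ ^ 2 by positivity]
  have h' := h.weaklyAdmissible hε hK
  exact ⟨gap φ ε hφ hε hε' S₁ S₂ H d ds h',
    separation ε hε S₁ S₂ H ds (h'.one_le_mul hε (by linarith)) h.source_le⟩
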